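/- Let $G$ be a compact Lie group of dimension $n$ with its normalized Haar measure, and let $k$ be an integer with $k>n/2$. Let $A:C^\infty(G)\to C^\infty(G)$ be a continuous linear operator, where $C^\infty(G)$ (complex-valued functions) carries its usual Fréchet topology. For $x\in G$ let $r_x\in\mathcal D'(G)$ be the right-convolution kernel of $A$ at $x$, i.e. the distribution with $Af(x)=\int_G f(y)\,r_x(y^{-1}x)\,dy$ for all $f\in C^\infty(G)$ (in the sense of distributions). For every continuous irreducible unitary representation $\xi$ of $G$ on a (necessarily finite-dimensional) Hilbert space $\mathcal H_\xi$ let $$\sigma_A(x,\xi)=\int_G r_x(y)\,\xi(y)^*\,dy\in\mathrm{End}(\mathcal H_\xi)$$ be the symbol of $A$. Let $\partial_1,\dots,\partial_n$ be the left-invariant vector fields on $G$ corresponding to a basis of its Lie algebra, and put $\partial_x^\alpha=\partial_1^{\alpha_1}\cdots\partial_n^{\alpha_n}$ for $\alpha\in\mathbb N_0^n$. Assume that there is a constant $C$ such that $$\|\partial_x^\alpha\sigma_A(x,\xi)\|_{op}\le C$$ for all $x\in G$, all continuous irreducible unitary representations $\xi$ of $G$ and all $\alpha$ with $|\alpha|\le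 k$, where $\|\cdot\|_{op}$ is the operator norm on $\mathrm{End}(\mathcal H_\xi)$. Then $A$ is bounded on $L^2(G)$, that is, $A$ extends to a bounded linear operator $L^2(G)\to L^2(G)$. -/

import Mathlib

open MeasureTheory
open scoped Manifold ContDiff

noncomputable section

namespace LieGroupSymbol

section Derivatives

variable {n : ℕ} {G : Type*} [Group G] [TopologicalSpace G]
  [ChartedSpace (EuclideanSpace ℝ (Fin n)) G]
  {F : Type*} [NormedAddCommGroup F] [NormedSpace ℝ F]

/-- The first-order differential operator given by an element `X` of the Lie algebra, i.e. the
derivative `d/dt f (x exp (t X))` at `t = 0` along the left-invariant vector field of `X`. -/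
def lieDeriv (X : GroupLieAlgebra (𝓡 n) G) (f : G → F) : G → F :=
  fun x => mfderiv (𝓡 n) 𝓘(ℝ, F) f x (mulInvariantVectorField X x)

/-- For a list `[X₁, …, Xₘ]`, the function `X₁ (X₂ (⋯ (Xₘ f)))`. -/
def iterLieDeriv (L : List (GroupLieAlgebra (𝓡 n) G)) (f : G → F) : G → F :=
  L.foldr lieDeriv f

/-- `∂^α = ∂₁^{α₁} ⋯ ∂ₙ^{αₙ}`, where `∂ᵢ` is the operator of the `i`-th basis vector. -/
def multiLieDeriv (b : Module.Basis (Fin n) ℝ (GroupLieAlgebra (𝓡 n) G)) (α : Fin n → ℕ)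
    (f : G → F) : G → F :=
  iterLieDeriv (List.ofFn fun i => List.replicate (α i) (b i)).flatten f

end Derivatives

section SmoothFunctions

/-- The space `C^∞(G)` of smooth complex-valued functions. -/
abbrev SmoothFun (n : ℕ) (G : Type*) [TopologicalSpace G]
    [ChartedSpace (EuclideanSpace ℝ (Fin n)) G] : Type _ :=
  C^∞⟮𝓡 n, G; 𝓘(ℝ, ℂ), ℂ⟯

variable {n : ℕ} {G : Type*} [TopologicalSpace G] [ChartedSpace (EuclideanSpace ℝ (Fin n)) G]

instance : SMul ℂ (SmoothFun n G) where
  smul c f := ⟨fun x => c * f x, (ContinuousLinearMap.mul ℝ ℂ c).contMDiff.comp f.contMDiff⟩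

theorem coe_complex_smul (c : ℂ) (f : SmoothFun n G) : ⇑(c • f) = c • ⇑f := rfl

instance : Module ℂ (SmoothFun n G) :=
  Function.Injective.module ℂ ContMDiffMap.coeFnAddMonoidHom ContMDiffMap.coe_injective
    coe_complex_smul

/-- The usual topology of `C^∞(G)`: `f` is close to `g` when finitely many of the functions
`X₁ ⋯ Xₘ f` (with `m ≥ 0` and `X₁, …, Xₘ` left-invariant vector fields) are uniformly close to
`X₁ ⋯ Xₘ g`. -/
instance [Group G] : TopologicalSpace (SmoothFun n G) :=
  TopologicalSpace.induced
    (fun (f : SmoothFun n G) (L : List (GroupLieAlgebra (𝓡 n) G)) =>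
      UniformFun.ofFun (iterLieDeriv L f))
    inferInstance

/-- A smooth function on a compact space as an element of `L²`. -/
def toL2 [CompactSpace G] [MeasurableSpace G] [BorelSpace G] (μ : Measure G) [IsFiniteMeasure μ]
    (f : SmoothFun n G) : Lp ℂ 2 μ :=
  ContinuousMap.toLp 2 μ ℂ ⟨f, f.contMDiff.continuous⟩

end SmoothFunctions

section Representations

/-- The linear representation on `ℂ^d` given by a homomorphism `G → U(d)`. -/
def matrixRepresentation {G : Type*} [Group G] {d : ℕ}
    (ξ : G →* Matrix.unitaryGroup (Fin d) ℂ) : Representation ℂ G (Fin d → ℂ) :=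
  (Matrix.toLinAlgEquiv' : Matrix (Fin d) (Fin d) ℂ ≃ₐ[ℂ] _).toRingEquiv.toMonoidHom.comp
    ((Matrix.unitaryGroup (Fin d) ℂ).subtype.comp ξ)

/-- Continuous irreducible unitary (matrix) representations `ξ : G → U(d)`. The representation
space of a continuous irreducible unitary representation of a compact group is
finite-dimensional, so up to unitary equivalence these are all of them. -/
structure UnitaryIrrep (G : Type*) [Group G] [TopologicalSpace G] (d : ℕ) where
  toHom : G →* Matrix.unitaryGroup (Fin d) ℂ
  continuous_toHom : Continuous toHom
  irreducible : (matrixRepresentation toHom).IsIrreducible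

/-- The matrix `ξ(x)`. -/
def UnitaryIrrep.mat {G : Type*} [Group G] [TopologicalSpace G] {d : ℕ}
    (ξ : UnitaryIrrep G d) (x : G) : Matrix (Fin d) (Fin d) ℂ :=
  (ξ.toHom x).1

end Representations

section Symbols

variable {n : ℕ} {G : Type*} [Group G] [TopologicalSpace G]
  [ChartedSpace (EuclideanSpace ℝ (Fin n)) G]

/-- The smooth function `z ↦ φ (z⁻¹ x)`. -/
def reflect [LieGroup (𝓡 n) ∞ G] (x : G) (φ : SmoothFun n G) : SmoothFun n G :=
  ⟨fun z => φ (z⁻¹ * x), φ.contMDiff.comp ((contMDiff_inv (𝓡 n) ∞).mul contMDiff_const)⟩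

/-- The right-convolution kernel `r_x = R_A(x, ·)` of `A` at the point `x`, as a linear functional
on `C^∞(G)`. It is determined by `A f (x) = ∫ f(z) r_x(z⁻¹ x) dz = ∫ f(x y⁻¹) r_x(y) dy`; the choice
`f(z) = φ(z⁻¹ x)`, for which `f(x y⁻¹) = φ(y)`, gives its value at a test function `φ`. -/
def rightConvKernel [LieGroup (𝓡 n) ∞ G] (A : SmoothFun n G →L[ℂ] SmoothFun n G) (x : G) :
    SmoothFun n G →ₗ[ℂ] ℂ where
  toFun φ := A (reflect x φ) x
  map_add' φ ψ := by
    have h : reflect x (φ + ψ) = reflect x φ + reflect x ψ := by ext z; rfl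
    rw [h, map_add]; rfl
  map_smul' c φ := by
    have h : reflect x (c • φ) = c • reflect x φ := by ext z; rfl
    rw [h, map_smul]; rfl

open Classical in
/-- The value of a linear functional on `C^∞(G)` at a function given without a proof of its
smoothness. Below it is only used at matrix coefficients of continuous finite-dimensional
representations of Lie groups, and these are smooth. -/
def pairing (r : SmoothFun n G →ₗ[ℂ] ℂ) (f : G → ℂ) : ℂ :=
  if h : ContMDiff (𝓡 n) 𝓘(ℝ, ℂ) ∞ f then r (⟨f, h⟩ : SmoothFun n G) else 0

/-- The Fourier coefficient `r̂(ξ) = ∫ r(y) ξ(y)^* dy` of a distribution `r`, an endomorphism of the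
Hilbert space `ℂ^d`. Its `(i, j)` entry is the value of `r` at the function
`y ↦ (ξ(y)^*) i j`. -/
def distFourierCoeff (r : SmoothFun n G →ₗ[ℂ] ℂ) {d : ℕ} (ξ : UnitaryIrrep G d) :
    EuclideanSpace ℂ (Fin d) →L[ℂ] EuclideanSpace ℂ (Fin d) :=
  Matrix.toEuclideanCLM (𝕜 := ℂ)
    (Matrix.of fun i j => pairing r fun y => (ξ.mat y).conjTranspose i j)

/-- The symbol `σ_A(x, ξ)` of a continuous linear operator `A` on `C^∞(G)`: the Fourier coefficient
at `ξ` of the right-convolution kernel of `A` at `x`. -/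
def symbol [LieGroup (𝓡 n) ∞ G] (A : SmoothFun n G →L[ℂ] SmoothFun n G) (x : G) {d : ℕ}
    (ξ : UnitaryIrrep G d) : EuclideanSpace ℂ (Fin d) →L[ℂ] EuclideanSpace ℂ (Fin d) :=
  distFourierCoeff (rightConvKernel A x) ξ

end Symbols

end LieGroupSymbol

end

set_option linter.unusedSectionVars false

/-! Freeze the symbol: for fixed `y` let `A_y` be the left-invariant operator whose
right-convolution kernel is that of `A` at `y`, so that `A f x = A_x f x` (`frozen_self`). The
Sobolev inequality on `G` in the variable `y`, available because `k > n/2`, bounds `|A_x f x|²` by a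
constant times the sum over `|α| ≤ k` of `∫ |∂_y^α A_y f(x)|² dy`. Integrating in `x` and exchanging
the integrals leaves `∫ ‖∂_y^α A_y f‖² dy` to be bounded. For fixed `y`, the operator `∂_y^α A_y` is
a Fourier multiplier with symbol `∂_y^α σ_A(y, ξ)`, so its `L²` norm is at most `C`. This is
`norm_toL2_sq_le_of_hasFrozenBound`.

The multiplier bound is proved without the Plancherel formula. On an irreducible right-invariant
space of functions, an `L²`-orthonormal basis identifies the frozen operator with the symbol matrix
acting on coordinates, and the coordinates are isometric (`hasFrozenBound_of_irreducible`). A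
finite-dimensional right-invariant space is split orthogonally into smaller invariant pieces, and
Pythagoras keeps the same constant (`hasFrozenBound_of_finiteDimensional`).

This gives the estimate for functions with finitely many independent right translates. They are
dense in `C^∞(G)` (`dense_finiteFun`), a Peter–Weyl theorem in the Fréchet topology: convolutions
with symmetric bumps are compact self-adjoint operators on `L²` that commute with right translations
and map `L²` continuously into `C^∞(G)`. Both sides of the estimate are continuous on `C^∞(G)`, so
it holds everywhere, and `exists_clm_extension` extends the operator to `L²(G)`.

The Sobolev inequality (`exists_sobolev`) comes from the Euclidean one in a chart at `1`. Coordinate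
derivatives are expanded in the left-invariant frame, and the resulting words in the basis fields
are rewritten as ordered monomials by commutators. Averaging over left translates removes the
dependence on the chart, so Haar and Lebesgue measure never have to be compared. -/

noncomputable section

namespace LieGroupSymbol

open Set Filter Topology
open scoped ComplexConjugate

/-! ### Left-invariant derivatives in the chart at the identity. -/

section Calculus

/-- The derivative of a smooth family of maps in the vector variable depends smoothly on the
parameters. -/
theorem contMDiffAt_fderiv_param {E' H' N : Type*} [NormedAddCommGroup E'] [NormedSpace ℝ E']
    [TopologicalSpace H'] {J : ModelWithCorners ℝ E' H'} [TopologicalSpace N] [ChartedSpace H' N]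
    [IsManifold J ∞ N]
    {E : Type*} [NormedAddCommGroup E] [NormedSpace ℝ E]
    {F : Type*} [NormedAddCommGroup F] [NormedSpace ℝ F]
    {Φ : N → E → F} {g : N → E} {x₀ : N}
    (hΦ : ContMDiffAt (J.prod 𝓘(ℝ, E)) 𝓘(ℝ, F) ∞ (Function.uncurry Φ) (x₀, g x₀))
    (hg : ContMDiffAt J 𝓘(ℝ, E) ∞ g x₀) :
    ContMDiffAt J 𝓘(ℝ, E →L[ℝ] F) ∞ (fun x => fderiv ℝ (Φ x) (g x)) x₀ := by
  have h := ContMDiffAt.mfderiv (m := ∞) Φ g hΦ hg (by simp)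
  simpa only [inTangentCoordinates_model_space, mfderiv_eq_fderiv] using h

variable {n : ℕ} {G : Type*} [Group G] [TopologicalSpace G]
  [ChartedSpace (EuclideanSpace ℝ (Fin n)) G]

variable (n G) in
/-- The inverse of the preferred chart at the identity. -/
def loc (u : EuclideanSpace ℝ (Fin n)) : G := (extChartAt (𝓡 n) (1 : G)).symm u

variable (n G) in
/-- The image of the identity in the preferred chart. -/
def origin : EuclideanSpace ℝ (Fin n) := extChartAt (𝓡 n) (1 : G) 1

variable (n G) in
/-- The target of the preferred chart at the identity. -/
def dom : Set (EuclideanSpace ℝ (Fin n)) := (extChartAt (𝓡 n) (1 : G)).target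

theorem isOpen_dom : IsOpen (dom n G) := isOpen_extChartAt_target _

theorem origin_mem_dom : origin n G ∈ dom n G := mem_extChartAt_target _

theorem dom_mem_nhds : dom n G ∈ 𝓝 (origin n G) := isOpen_dom.mem_nhds origin_mem_dom

@[simp] theorem loc_origin : loc n G (origin n G) = 1 := extChartAt_to_inv (I := 𝓡 n) (1 : G)

/-- The identification of the Lie algebra with the model space of the manifold. -/
def coord : GroupLieAlgebra (𝓡 n) G ≃ₗ[ℝ] EuclideanSpace ℝ (Fin n) :=
  LinearEquiv.refl ℝ (EuclideanSpace ℝ (Fin n))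

theorem lieDeriv_eq_mfderiv_mul [LieGroup (𝓡 n) ∞ G] {F : Type*} [NormedAddCommGroup F]
    [NormedSpace ℝ F] (X : GroupLieAlgebra (𝓡 n) G) {f : G → F} {x : G}
    (hf : MDifferentiableAt (𝓡 n) 𝓘(ℝ, F) f x) :
    lieDeriv X f x = mfderiv (𝓡 n) 𝓘(ℝ, F) (fun h => f (x * h)) 1 X := by
  have hm : MDifferentiableAt (𝓡 n) (𝓡 n) (fun h : G => x * h) 1 :=
    (contMDiff_mul_left (I := 𝓡 n) (n := ∞) (a := x)).contMDiffAt.mdifferentiableAt (by simp)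
  have hf' : MDifferentiableAt (𝓡 n) 𝓘(ℝ, F) f (x * 1) := by rwa [mul_one]
  have h := mfderiv_comp (I := 𝓡 n) (I' := 𝓡 n) (I'' := 𝓘(ℝ, F)) (1 : G) hf' hm
  have h2 := congrArg (fun (T : EuclideanSpace ℝ (Fin n) →L[ℝ] F) => T X) h
  refine Eq.trans ?_ h2.symm
  show _ = mfderiv (𝓡 n) 𝓘(ℝ, F) f (x * 1) (mfderiv (𝓡 n) (𝓡 n) (fun h : G => x * h) 1 X)
  simp only [lieDeriv, mulInvariantVectorField]
  congr 2
  all_goals simp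

/-- Left translation moves the field at `x` to the identity, where the chart turns it into a
Euclidean derivative at one fixed point. The base point `x` survives only as a parameter, so
smoothness in `x` reduces to smoothness of derivatives with parameters. -/
theorem lieDeriv_eq_fderiv [LieGroup (𝓡 n) ∞ G] {F : Type*} [NormedAddCommGroup F]
    [NormedSpace ℝ F] (X : GroupLieAlgebra (𝓡 n) G) {f : G → F} {x : G}
    (hf : MDifferentiableAt (𝓡 n) 𝓘(ℝ, F) f x) :
    lieDeriv X f x = fderiv ℝ (fun u => f (x * loc n G u)) (origin n G) (coord X) := by
  have hm : MDifferentiableAt (𝓡 n) (𝓡 n) (fun h : G => x * h) 1 :=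
    (contMDiff_mul_left (I := 𝓡 n) (n := ∞) (a := x)).contMDiffAt.mdifferentiableAt (by simp)
  have hf' : MDifferentiableAt (𝓡 n) 𝓘(ℝ, F) f (x * 1) := by rwa [mul_one]
  have hc : MDifferentiableAt (𝓡 n) 𝓘(ℝ, F) (fun h => f (x * h)) 1 := hf'.comp (1 : G) hm
  have h := hc.mfderiv
  simp only [writtenInExtChartAt, extChartAt_model_space_eq_id, ModelWithCorners.range_eq_univ,
      fderivWithin_univ] at h
  rw [lieDeriv_eq_mfderiv_mul X hf]
  exact congrArg (fun (T : EuclideanSpace ℝ (Fin n) →L[ℝ] F) => T (coord X)) h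

/-- Smoothness of a map from the group to a normed space. -/
abbrev IsSmooth (n : ℕ) {G : Type*} [TopologicalSpace G]
    [ChartedSpace (EuclideanSpace ℝ (Fin n)) G] {F : Type*} [NormedAddCommGroup F]
    [NormedSpace ℝ F] (f : G → F) : Prop :=
  ContMDiff (𝓡 n) 𝓘(ℝ, F) ∞ f

section

variable [LieGroup (𝓡 n) ∞ G] {F : Type*} [NormedAddCommGroup F] [NormedSpace ℝ F]
  {F' : Type*} [NormedAddCommGroup F'] [NormedSpace ℝ F']

theorem contMDiffAt_loc {u : EuclideanSpace ℝ (Fin n)} (hu : u ∈ dom n G) :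
    ContMDiffAt 𝓘(ℝ, EuclideanSpace ℝ (Fin n)) (𝓡 n) ∞ (loc n G) u :=
  (contMDiffOn_extChartAt_symm (I := 𝓡 n) (n := ∞) (1 : G)).contMDiffAt (isOpen_dom.mem_nhds hu)

theorem contMDiffAt_mul_loc (x : G) {u : EuclideanSpace ℝ (Fin n)} (hu : u ∈ dom n G) :
    ContMDiffAt ((𝓡 n).prod 𝓘(ℝ, EuclideanSpace ℝ (Fin n))) (𝓡 n) ∞
      (fun p : G × EuclideanSpace ℝ (Fin n) => p.1 * loc n G p.2) (x, u) :=
  contMDiffAt_fst.mul (ContMDiffAt.comp (x, u) (contMDiffAt_loc hu) contMDiffAt_snd)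

theorem IsSmooth.mdifferentiableAt {f : G → F} (hf : IsSmooth n f) (x : G) :
    MDifferentiableAt (𝓡 n) 𝓘(ℝ, F) f x := hf.contMDiffAt.mdifferentiableAt (by simp)

theorem IsSmooth.contDiffAt_loc {f : G → F} (hf : IsSmooth n f) (x : G)
    {u : EuclideanSpace ℝ (Fin n)} (hu : u ∈ dom n G) :
    ContDiffAt ℝ ∞ (fun u => f (x * loc n G u)) u := by
  rw [← contMDiffAt_iff_contDiffAt]
  exact hf.contMDiffAt.comp u ((contMDiffAt_const (c := x)).mul (contMDiffAt_loc hu))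

theorem IsSmooth.differentiableAt_loc {f : G → F} (hf : IsSmooth n f) (x : G) :
    DifferentiableAt ℝ (fun u => f (x * loc n G u)) (origin n G) :=
  (hf.contDiffAt_loc x origin_mem_dom).differentiableAt (by simp)

/-- Left translation by `x` carries the chart at `1` to a chart around `x`, so a single chart tests
smoothness everywhere. -/
theorem IsSmooth.of_contDiffAt_loc {f : G → F}
    (hf : ∀ x, ContDiffAt ℝ ∞ (fun u => f (x * loc n G u)) (origin n G)) : IsSmooth n f := by
  intro x
  have h1 : ContMDiffAt (𝓡 n) (𝓡 n) ∞ (fun y => x⁻¹ * y) x :=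
    contMDiff_mul_left.contMDiffAt
  have h2 : ContMDiffAt (𝓡 n) 𝓘(ℝ, EuclideanSpace ℝ (Fin n)) ∞ (extChartAt (𝓡 n) (1 : G))
      (x⁻¹ * x) := by
    rw [inv_mul_cancel]; exact contMDiffAt_extChartAt
  have h3 := ContMDiffAt.comp x h2 h1
  have h4 : ContMDiffAt 𝓘(ℝ, EuclideanSpace ℝ (Fin n)) 𝓘(ℝ, F) ∞ (fun u => f (x * loc n G u))
      (((extChartAt (𝓡 n) (1 : G)) ∘ fun y => x⁻¹ * y) x) := by
    rw [contMDiffAt_iff_contDiffAt]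
    simpa only [Function.comp_apply, inv_mul_cancel, origin] using hf x
  refine (ContMDiffAt.comp x h4 h3).congr_of_eventuallyEq ?_
  have h5 : ∀ᶠ y in 𝓝 x, x⁻¹ * y ∈ (extChartAt (𝓡 n) (1 : G)).source := by
    apply h1.continuousAt
    simp only [inv_mul_cancel]
    exact extChartAt_source_mem_nhds (1 : G)
  filter_upwards [h5] with y hy
  simp only [Function.comp_apply, loc]
  rw [(extChartAt (𝓡 n) (1 : G)).left_inv hy, mul_inv_cancel_left]

theorem IsSmooth.lieDeriv {f : G → F} (hf : IsSmooth n f) (X : GroupLieAlgebra (𝓡 n) G) :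
    IsSmooth n (lieDeriv X f) := by
  have h : LieGroupSymbol.lieDeriv X f =
      fun x => fderiv ℝ (fun u => f (x * loc n G u)) (origin n G) (coord X) :=
    funext fun x => lieDeriv_eq_fderiv X (hf.mdifferentiableAt x)
  rw [h]
  intro x
  exact (contMDiffAt_fderiv_param (Φ := fun x u => f (x * loc n G u)) (g := fun _ => origin n G)
    (hf.contMDiffAt.comp _ (contMDiffAt_mul_loc x origin_mem_dom)) contMDiffAt_const).clm_apply
    contMDiffAt_const

theorem contMDiff_lieDeriv_param {E' H' N : Type*} [NormedAddCommGroup E'] [NormedSpace ℝ E']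
    [TopologicalSpace H'] {J : ModelWithCorners ℝ E' H'} [TopologicalSpace N] [ChartedSpace H' N]
    [IsManifold J ∞ N] {f : G → N → F}
    (hf : ContMDiff ((𝓡 n).prod J) 𝓘(ℝ, F) ∞ (Function.uncurry f))
    (X : GroupLieAlgebra (𝓡 n) G) :
    ContMDiff ((𝓡 n).prod J) 𝓘(ℝ, F) ∞
      (fun p : G × N => lieDeriv X (fun x => f x p.2) p.1) := by
  have hs : ∀ z, IsSmooth n (fun x => f x z) := fun z =>
    hf.comp (contMDiff_id.prodMk contMDiff_const)
  have h : (fun p : G × N => lieDeriv X (fun x => f x p.2) p.1) =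
      fun p => fderiv ℝ (fun u => f (p.1 * loc n G u) p.2) (origin n G) (coord X) :=
    funext fun p => lieDeriv_eq_fderiv X ((hs p.2).mdifferentiableAt p.1)
  rw [h]
  intro p
  refine (contMDiffAt_fderiv_param (Φ := fun (p : G × N) u => f (p.1 * loc n G u) p.2)
    (g := fun _ => origin n G) ?_ contMDiffAt_const).clm_apply contMDiffAt_const
  have h1 : ContMDiffAt (((𝓡 n).prod J).prod 𝓘(ℝ, EuclideanSpace ℝ (Fin n))) ((𝓡 n).prod J) ∞
      (fun q : (G × N) × EuclideanSpace ℝ (Fin n) => (q.1.1 * loc n G q.2, q.1.2))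
      (p, origin n G) := by
    refine ContMDiffAt.prodMk ?_ ?_
    · exact ContMDiffAt.mul (contMDiffAt_fst.comp _ contMDiffAt_fst)
        (ContMDiffAt.comp (p, origin n G) (contMDiffAt_loc origin_mem_dom) contMDiffAt_snd)
    · exact contMDiffAt_snd.comp _ contMDiffAt_fst
  exact hf.contMDiffAt.comp _ h1

theorem lieDeriv_add (X : GroupLieAlgebra (𝓡 n) G) {f g : G → F} (hf : IsSmooth n f)
    (hg : IsSmooth n g) : lieDeriv X (f + g) = lieDeriv X f + lieDeriv X g := by
  ext x
  rw [Pi.add_apply, lieDeriv_eq_fderiv X (IsSmooth.mdifferentiableAt (hf.add hg) x),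
    lieDeriv_eq_fderiv X (hf.mdifferentiableAt x), lieDeriv_eq_fderiv X (hg.mdifferentiableAt x)]
  have := fderiv_add (hf.differentiableAt_loc x) (hg.differentiableAt_loc x)
  exact congrArg (fun (T : EuclideanSpace ℝ (Fin n) →L[ℝ] F) => T (coord X)) this

theorem IsSmooth.clm_comp {f : G → F} (hf : IsSmooth n f) (T : F →L[ℝ] F') :
    IsSmooth n (fun x => T (f x)) := T.contMDiff.comp hf

theorem lieDeriv_clm_comp (X : GroupLieAlgebra (𝓡 n) G) {f : G → F} (hf : IsSmooth n f)
    (T : F →L[ℝ] F') : lieDeriv X (fun x => T (f x)) = fun x => T (lieDeriv X f x) := by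
  ext x
  rw [lieDeriv_eq_fderiv X ((hf.clm_comp T).mdifferentiableAt x),
    lieDeriv_eq_fderiv X (hf.mdifferentiableAt x)]
  have h := T.hasFDerivAt.comp (origin n G) (hf.differentiableAt_loc x).hasFDerivAt
  exact congrArg (fun (T : EuclideanSpace ℝ (Fin n) →L[ℝ] F') => T (coord X)) h.fderiv

theorem IsSmooth.mul_left {f : G → F} (hf : IsSmooth n f) (g : G) :
    IsSmooth n (fun x => f (g * x)) := hf.comp contMDiff_mul_left

theorem IsSmooth.mul_right {f : G → F} (hf : IsSmooth n f) (g : G) :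
    IsSmooth n (fun x => f (x * g)) := hf.comp contMDiff_mul_right

theorem lieDeriv_mul_left (X : GroupLieAlgebra (𝓡 n) G) {f : G → F} (hf : IsSmooth n f) (g : G) :
    lieDeriv X (fun x => f (g * x)) = fun x => lieDeriv X f (g * x) := by
  ext x
  rw [lieDeriv_eq_fderiv X ((hf.mul_left g).mdifferentiableAt x),
    lieDeriv_eq_fderiv X (hf.mdifferentiableAt _)]
  simp only [mul_assoc]

theorem lieDeriv_add_vec (X Y : GroupLieAlgebra (𝓡 n) G) (f : G → F) :
    lieDeriv (X + Y) f = lieDeriv X f + lieDeriv Y f := by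
  ext x
  simp only [LieGroupSymbol.lieDeriv, mulInvariantVectorField_add, Pi.add_apply]
  exact map_add (mfderiv (𝓡 n) 𝓘(ℝ, F) f x) _ _

theorem lieDeriv_smul_vec (c : ℝ) (X : GroupLieAlgebra (𝓡 n) G) (f : G → F) :
    lieDeriv (c • X) f = c • lieDeriv X f := by
  ext x
  simp only [LieGroupSymbol.lieDeriv, mulInvariantVectorField_smul, Pi.smul_apply]
  exact map_smul (mfderiv (𝓡 n) 𝓘(ℝ, F) f x) _ _

@[simp] theorem iterLieDeriv_nil (f : G → F) :
    iterLieDeriv ([] : List (GroupLieAlgebra (𝓡 n) G)) f = f := rfl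

theorem iterLieDeriv_cons (X : GroupLieAlgebra (𝓡 n) G) (L : List (GroupLieAlgebra (𝓡 n) G))
    (f : G → F) : iterLieDeriv (X :: L) f = lieDeriv X (iterLieDeriv L f) := rfl

theorem iterLieDeriv_append (L L' : List (GroupLieAlgebra (𝓡 n) G)) (f : G → F) :
    iterLieDeriv (L ++ L') f = iterLieDeriv L (iterLieDeriv L' f) := List.foldr_append

theorem IsSmooth.iterLieDeriv {f : G → F} (hf : IsSmooth n f)
    (L : List (GroupLieAlgebra (𝓡 n) G)) : IsSmooth n (iterLieDeriv L f) := by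
  induction L with
  | nil => exact hf
  | cons X L ih => exact ih.lieDeriv X

theorem iterLieDeriv_add (L : List (GroupLieAlgebra (𝓡 n) G)) {f g : G → F} (hf : IsSmooth n f)
    (hg : IsSmooth n g) : iterLieDeriv L (f + g) = iterLieDeriv L f + iterLieDeriv L g := by
  induction L with
  | nil => rfl
  | cons X L ih =>
    simp only [iterLieDeriv_cons, ih]
    exact lieDeriv_add X (hf.iterLieDeriv L) (hg.iterLieDeriv L)

theorem iterLieDeriv_clm_comp (L : List (GroupLieAlgebra (𝓡 n) G)) {f : G → F}
    (hf : IsSmooth n f) (T : F →L[ℝ] F') :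
    iterLieDeriv L (fun x => T (f x)) = fun x => T (iterLieDeriv L f x) := by
  induction L with
  | nil => rfl
  | cons X L ih =>
    simp only [iterLieDeriv_cons, ih]
    exact lieDeriv_clm_comp X (hf.iterLieDeriv L) T

theorem iterLieDeriv_mul_left (L : List (GroupLieAlgebra (𝓡 n) G)) {f : G → F}
    (hf : IsSmooth n f) (g : G) :
    iterLieDeriv L (fun x => f (g * x)) = fun x => iterLieDeriv L f (g * x) := by
  induction L with
  | nil => rfl
  | cons X L ih =>
    simp only [iterLieDeriv_cons, ih]
    exact lieDeriv_mul_left X (hf.iterLieDeriv L) g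

theorem contMDiff_iterLieDeriv_param {E' H' N : Type*} [NormedAddCommGroup E'] [NormedSpace ℝ E']
    [TopologicalSpace H'] {J : ModelWithCorners ℝ E' H'} [TopologicalSpace N] [ChartedSpace H' N]
    [IsManifold J ∞ N] {f : G → N → F}
    (hf : ContMDiff ((𝓡 n).prod J) 𝓘(ℝ, F) ∞ (Function.uncurry f))
    (L : List (GroupLieAlgebra (𝓡 n) G)) :
    ContMDiff ((𝓡 n).prod J) 𝓘(ℝ, F) ∞
      (fun p : G × N => iterLieDeriv L (fun x => f x p.2) p.1) := by
  induction L with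
  | nil => exact hf
  | cons X L ih =>
    exact contMDiff_lieDeriv_param (f := fun x z => iterLieDeriv L (fun x => f x z) x) ih X

end

end Calculus

/-! ### Differentiation under the integral sign over a compact manifold. -/

section ParametricIntegral

variable {E : Type} [NormedAddCommGroup E] [NormedSpace ℝ E] [ProperSpace E]
  {E' H' N : Type*} [NormedAddCommGroup E'] [NormedSpace ℝ E']
  [TopologicalSpace H'] {J : ModelWithCorners ℝ E' H'} [TopologicalSpace N] [ChartedSpace H' N]
  [IsManifold J ∞ N] [CompactSpace N] [SecondCountableTopology N] [MeasurableSpace N]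
  [BorelSpace N] {μ : Measure N} {h : N → ℂ}

theorem contMDiffOn_fderiv_param {F : Type*} [NormedAddCommGroup F] [NormedSpace ℝ F]
    {U : Set E} (hU : IsOpen U) {Φ : E → N → F}
    (hΦ : ContMDiffOn (𝓘(ℝ, E).prod J) 𝓘(ℝ, F) ∞ (Function.uncurry Φ) (U ×ˢ univ)) :
    ContMDiffOn (𝓘(ℝ, E).prod J) 𝓘(ℝ, E →L[ℝ] F) ∞
      (Function.uncurry fun u z => fderiv ℝ (fun v => Φ v z) u) (U ×ˢ univ) := by
  rintro ⟨u, z⟩ hp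
  refine ContMDiffAt.contMDiffWithinAt ?_
  refine contMDiffAt_fderiv_param (J := 𝓘(ℝ, E).prod J) (N := E × N)
    (Φ := fun p v => Φ v p.2) (g := fun p => p.1) ?_ contMDiffAt_fst
  have h1 : ContMDiffAt (𝓘(ℝ, E).prod J) 𝓘(ℝ, F) ∞ (Function.uncurry Φ) (u, z) :=
    hΦ.contMDiffAt ((hU.prod isOpen_univ).mem_nhds hp)
  have h2 : ContMDiffAt ((𝓘(ℝ, E).prod J).prod 𝓘(ℝ, E)) (𝓘(ℝ, E).prod J) ∞
      (fun q : (E × N) × E => (q.2, q.1.2)) ((u, z), u) :=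
    contMDiffAt_snd.prodMk (contMDiffAt_snd.comp _ contMDiffAt_fst)
  exact ContMDiffAt.comp ((u, z), u) (g := Function.uncurry Φ) h1 h2

theorem continuous_of_continuousOn_prod_univ {F : Type*} [TopologicalSpace F] {U : Set E}
    {Ψ : E → N → F} (hΨ : ContinuousOn (Function.uncurry Ψ) (U ×ˢ univ)) {v : E} (hv : v ∈ U) :
    Continuous (Ψ v) :=
  hΨ.comp_continuous (f := fun z => (v, z)) (by fun_prop) fun _ => ⟨hv, mem_univ _⟩

/-- Compactness of a closed ball times `N` bounds the integrand and its derivative uniformly, so a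
multiple of `‖h‖` serves as the dominating function. -/
theorem hasFDerivAt_integral_param {F : Type*} [NormedAddCommGroup F] [NormedSpace ℝ F]
    [NormedSpace ℂ F] [IsScalarTower ℝ ℂ F] [SMulCommClass ℝ ℂ F] (hh : Integrable h μ)
    {U : Set E} (hU : IsOpen U) {Φ : E → N → F}
    (hΦ : ContMDiffOn (𝓘(ℝ, E).prod J) 𝓘(ℝ, F) ∞ (Function.uncurry Φ) (U ×ˢ univ))
    {u : E} (hu : u ∈ U) :
    HasFDerivAt (fun u => ∫ z, h z • Φ u z ∂μ) (∫ z, h z • fderiv ℝ (fun v => Φ v z) u ∂μ) u := by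
  have hΦ' := contMDiffOn_fderiv_param hU hΦ
  obtain ⟨r, hr, hrU⟩ := Metric.nhds_basis_closedBall.mem_iff.1 (hU.mem_nhds hu)
  have hK : IsCompact (Metric.closedBall u r ×ˢ (univ : Set N)) :=
    (isCompact_closedBall u r).prod isCompact_univ
  obtain ⟨C, hC⟩ := hK.exists_bound_of_continuousOn
    (hΦ'.continuousOn.mono (prod_mono hrU Subset.rfl))
  obtain ⟨C₀, hC₀⟩ := hK.exists_bound_of_continuousOn
    (hΦ.continuousOn.mono (prod_mono hrU Subset.rfl))
  refine hasFDerivAt_integral_of_dominated_of_fderiv_le (𝕜 := ℝ)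
    (F' := fun u z => h z • fderiv ℝ (fun v => Φ v z) u)
    (bound := fun z => ‖h z‖ * C) (Metric.closedBall_mem_nhds u hr) ?_ ?_ ?_ ?_ ?_ ?_
  · filter_upwards [hU.mem_nhds hu] with v hv
    exact hh.aestronglyMeasurable.smul
      (continuous_of_continuousOn_prod_univ hΦ.continuousOn hv).aestronglyMeasurable
  · refine (hh.norm.mul_const C₀).mono'
      (hh.aestronglyMeasurable.smul
        (continuous_of_continuousOn_prod_univ hΦ.continuousOn hu).aestronglyMeasurable) ?_
    refine Eventually.of_forall fun z => ?_
    rw [norm_smul]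
    exact mul_le_mul_of_nonneg_left (hC₀ (u, z) ⟨Metric.mem_closedBall_self hr.le, mem_univ _⟩)
      (norm_nonneg _)
  · exact hh.aestronglyMeasurable.smul
      (continuous_of_continuousOn_prod_univ hΦ'.continuousOn hu).aestronglyMeasurable
  · refine Eventually.of_forall fun z v hv => ?_
    rw [norm_smul]
    exact mul_le_mul_of_nonneg_left (hC (v, z) ⟨hv, mem_univ _⟩) (norm_nonneg _)
  · exact hh.norm.mul_const C
  · refine Eventually.of_forall fun z v hv => ?_
    have h1 : ContMDiffAt 𝓘(ℝ, E) 𝓘(ℝ, F) ∞ (fun w => Φ w z) v :=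
      ContMDiffAt.comp v (g := Function.uncurry Φ) (f := fun w => (w, z))
        (hΦ.contMDiffAt ((hU.prod isOpen_univ).mem_nhds ⟨hrU hv, mem_univ _⟩))
        (contMDiffAt_id.prodMk contMDiffAt_const)
    have h2 : DifferentiableAt ℝ (fun w => Φ w z) v :=
      (contMDiffAt_iff_contDiffAt.1 h1).differentiableAt (by simp)
    exact h2.hasFDerivAt.const_smul (h z)

/-- The derivative is an integral of the same kind with values in `E →L[ℝ] F`; hence the induction
runs over all target spaces `F` at once. With `E` in the lowest universe, the new target stays in
the universe of `F`. -/
theorem contDiffOn_integral_param (m : ℕ) : ∀ {F : Type*} [NormedAddCommGroup F] [NormedSpace ℝ F]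
    [NormedSpace ℂ F] [IsScalarTower ℝ ℂ F] [SMulCommClass ℝ ℂ F] (_ : Integrable h μ)
    {U : Set E} (_ : IsOpen U) {Φ : E → N → F}
    (_ : ContMDiffOn (𝓘(ℝ, E).prod J) 𝓘(ℝ, F) ∞ (Function.uncurry Φ) (U ×ˢ univ)),
    ContDiffOn ℝ m (fun u => ∫ z, h z • Φ u z ∂μ) U := by
  induction m with
  | zero =>
    intro F _ _ _ _ _ hh U hU Φ hΦ
    exact contDiffOn_zero.2 fun u hu =>
      (hasFDerivAt_integral_param hh hU hΦ hu).continuousAt.continuousWithinAt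
  | succ m ih =>
    intro F _ _ _ _ _ hh U hU Φ hΦ
    push_cast
    rw [contDiffOn_succ_iff_fderiv_of_isOpen hU]
    refine ⟨fun u hu => (hasFDerivAt_integral_param hh hU hΦ hu).differentiableAt
      |>.differentiableWithinAt, by simp, ?_⟩
    exact (ih hh hU (contMDiffOn_fderiv_param hU hΦ)).congr fun u hu =>
      (hasFDerivAt_integral_param hh hU hΦ hu).fderiv

end ParametricIntegral

section

variable {n : ℕ} {G : Type*} [Group G] [TopologicalSpace G]
  [ChartedSpace (EuclideanSpace ℝ (Fin n)) G] [LieGroup (𝓡 n) ∞ G]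
  {E' H' N : Type*} [NormedAddCommGroup E'] [NormedSpace ℝ E']
  [TopologicalSpace H'] {J : ModelWithCorners ℝ E' H'} [TopologicalSpace N] [ChartedSpace H' N]
  [IsManifold J ∞ N] [CompactSpace N] [SecondCountableTopology N] [MeasurableSpace N]
  [BorelSpace N] {μ : Measure N} {h : N → ℂ}

theorem contMDiffOn_mul_loc_param {k : G → N → ℂ}
    (hk : ContMDiff ((𝓡 n).prod J) 𝓘(ℝ, ℂ) ∞ (Function.uncurry k)) (x : G) :
    ContMDiffOn (𝓘(ℝ, EuclideanSpace ℝ (Fin n)).prod J) 𝓘(ℝ, ℂ) ∞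
      (Function.uncurry fun u z => k (x * loc n G u) z) (dom n G ×ˢ univ) := by
  rintro ⟨u, z⟩ ⟨hu, -⟩
  refine ContMDiffAt.contMDiffWithinAt ?_
  refine ContMDiffAt.comp (u, z) (g := Function.uncurry k)
    (f := fun p : EuclideanSpace ℝ (Fin n) × N => (x * loc n G p.1, p.2)) hk.contMDiffAt ?_
  exact (ContMDiffAt.mul contMDiffAt_const
    (ContMDiffAt.comp (u, z) (contMDiffAt_loc hu) contMDiffAt_fst)).prodMk contMDiffAt_snd

theorem isSmooth_integral_param (hh : Integrable h μ) {k : G → N → ℂ}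
    (hk : ContMDiff ((𝓡 n).prod J) 𝓘(ℝ, ℂ) ∞ (Function.uncurry k)) :
    IsSmooth n (fun x => ∫ z, h z * k x z ∂μ) := by
  refine IsSmooth.of_contDiffAt_loc fun x => ?_
  rw [contDiffAt_infty]
  exact fun m => (contDiffOn_integral_param m hh isOpen_dom
    (contMDiffOn_mul_loc_param hk x)).contDiffAt dom_mem_nhds

theorem lieDeriv_integral_param (hh : Integrable h μ) {k : G → N → ℂ}
    (hk : ContMDiff ((𝓡 n).prod J) 𝓘(ℝ, ℂ) ∞ (Function.uncurry k))
    (X : GroupLieAlgebra (𝓡 n) G) :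
    lieDeriv X (fun x => ∫ z, h z * k x z ∂μ) =
      fun x => ∫ z, h z * lieDeriv X (fun y => k y z) x ∂μ := by
  ext x
  have hs : ∀ z, IsSmooth n (fun x => k x z) := fun z =>
    hk.comp (contMDiff_id.prodMk contMDiff_const)
  rw [lieDeriv_eq_fderiv X (IsSmooth.mdifferentiableAt (isSmooth_integral_param hh hk) x)]
  have h1 := (hasFDerivAt_integral_param hh isOpen_dom (contMDiffOn_mul_loc_param hk x)
    (origin_mem_dom (n := n) (G := G)))
  simp only [smul_eq_mul] at h1
  rw [h1.fderiv]
  have h2 := contMDiffOn_fderiv_param isOpen_dom (contMDiffOn_mul_loc_param hk x)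
  have hc : Continuous fun z => fderiv ℝ (fun v => k (x * loc n G v) z) (origin n G) :=
    h2.continuousOn.comp_continuous (f := fun z => (origin n G, z)) (by fun_prop)
      fun z => ⟨origin_mem_dom, mem_univ _⟩
  obtain ⟨C, hC⟩ := isCompact_univ.exists_bound_of_continuousOn hc.continuousOn
  have h_int : Integrable
      (fun z => h z • fderiv ℝ (fun v => k (x * loc n G v) z) (origin n G)) μ := by
    refine (hh.norm.mul_const C).mono' (hh.aestronglyMeasurable.smul hc.aestronglyMeasurable)
      (Eventually.of_forall fun z => ?_)
    rw [norm_smul]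
    exact mul_le_mul_of_nonneg_left (hC z (mem_univ _)) (norm_nonneg _)
  refine (ContinuousLinearMap.integral_apply h_int (coord X)).trans ?_
  refine integral_congr_ae (Eventually.of_forall fun z => ?_)
  simp only [lieDeriv_eq_fderiv X ((hs z).mdifferentiableAt x)]
  rfl

theorem iterLieDeriv_integral_param (hh : Integrable h μ) {k : G → N → ℂ}
    (hk : ContMDiff ((𝓡 n).prod J) 𝓘(ℝ, ℂ) ∞ (Function.uncurry k))
    (L : List (GroupLieAlgebra (𝓡 n) G)) :
    iterLieDeriv L (fun x => ∫ z, h z * k x z ∂μ) =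
      fun x => ∫ z, h z * iterLieDeriv L (fun y => k y z) x ∂μ := by
  induction L with
  | nil => rfl
  | cons X L ih =>
    simp only [iterLieDeriv_cons, ih]
    exact lieDeriv_integral_param (k := fun x z => iterLieDeriv L (fun y => k y z) x) hh
      (contMDiff_iterLieDeriv_param hk L) X

end

/-! ### Commutators of left-invariant fields. -/

section Commutator

variable {n : ℕ} {G : Type*} [Group G] [TopologicalSpace G]
  [ChartedSpace (EuclideanSpace ℝ (Fin n)) G] [LieGroup (𝓡 n) ∞ G]
  {F : Type*} [NormedAddCommGroup F] [NormedSpace ℝ F]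

variable (n G) in
/-- The left-invariant frame in the preferred chart at the identity: the derivative of
`v ↦ u * v` at the identity. -/
def frame (u : EuclideanSpace ℝ (Fin n)) :
    EuclideanSpace ℝ (Fin n) →L[ℝ] EuclideanSpace ℝ (Fin n) :=
  fderiv ℝ (fun v => extChartAt (𝓡 n) (1 : G) (loc n G u * loc n G v)) (origin n G)

theorem loc_mem_source {u : EuclideanSpace ℝ (Fin n)} (hu : u ∈ dom n G) :
    loc n G u ∈ (extChartAt (𝓡 n) (1 : G)).source :=
  (extChartAt (𝓡 n) (1 : G)).map_target hu

theorem contMDiffAt_extChartAt_loc_mul_loc {u : EuclideanSpace ℝ (Fin n)} (hu : u ∈ dom n G) :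
    ContMDiffAt (𝓘(ℝ, EuclideanSpace ℝ (Fin n)).prod 𝓘(ℝ, EuclideanSpace ℝ (Fin n)))
      𝓘(ℝ, EuclideanSpace ℝ (Fin n)) ∞
      (Function.uncurry fun u v => extChartAt (𝓡 n) (1 : G) (loc n G u * loc n G v))
      (u, origin n G) := by
  have h1 : ContMDiffAt (𝓘(ℝ, EuclideanSpace ℝ (Fin n)).prod 𝓘(ℝ, EuclideanSpace ℝ (Fin n)))
      (𝓡 n) ∞ (fun p : EuclideanSpace ℝ (Fin n) × EuclideanSpace ℝ (Fin n) =>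
        loc n G p.1 * loc n G p.2) (u, origin n G) :=
    (ContMDiffAt.comp (u, origin n G) (contMDiffAt_loc hu) contMDiffAt_fst).mul
      (ContMDiffAt.comp (u, origin n G) (contMDiffAt_loc origin_mem_dom) contMDiffAt_snd)
  have h2 : ContMDiffAt (𝓡 n) 𝓘(ℝ, EuclideanSpace ℝ (Fin n)) ∞ (extChartAt (𝓡 n) (1 : G))
      (loc n G u * loc n G (origin n G)) := by
    rw [loc_origin, mul_one]
    exact contMDiffAt_extChartAt' (by
      simpa only [extChartAt_source] using loc_mem_source hu)
  exact ContMDiffAt.comp (u, origin n G) h2 h1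

theorem contDiffAt_frame {u : EuclideanSpace ℝ (Fin n)} (hu : u ∈ dom n G) :
    ContDiffAt ℝ ∞ (frame n G) u := by
  rw [← contMDiffAt_iff_contDiffAt]
  exact contMDiffAt_fderiv_param
    (Φ := fun u v => extChartAt (𝓡 n) (1 : G) (loc n G u * loc n G v)) (g := fun _ => origin n G)
    (contMDiffAt_extChartAt_loc_mul_loc hu) contMDiffAt_const

theorem differentiableAt_frame_aux {u : EuclideanSpace ℝ (Fin n)} (hu : u ∈ dom n G) :
    DifferentiableAt ℝ (fun v => extChartAt (𝓡 n) (1 : G) (loc n G u * loc n G v))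
      (origin n G) := by
  have := ContMDiffAt.comp (origin n G)
    (f := fun v : EuclideanSpace ℝ (Fin n) => (u, v)) (contMDiffAt_extChartAt_loc_mul_loc hu)
    ((contMDiffAt_const).prodMk contMDiffAt_id)
  exact (contMDiffAt_iff_contDiffAt.1 this).differentiableAt (by simp)

theorem extChartAt_loc {u : EuclideanSpace ℝ (Fin n)} (hu : u ∈ dom n G) :
    extChartAt (𝓡 n) (1 : G) (loc n G u) = u :=
  (extChartAt (𝓡 n) (1 : G)).right_inv hu

theorem frame_origin : frame n G (origin n G) = ContinuousLinearMap.id ℝ _ := by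
  have : (fun v => extChartAt (𝓡 n) (1 : G) (loc n G (origin n G) * loc n G v))
      =ᶠ[𝓝 (origin n G)] fun v => v := by
    filter_upwards [dom_mem_nhds (n := n) (G := G)] with v hv
    rw [loc_origin, one_mul, extChartAt_loc hv]
  rw [frame, this.fderiv_eq, fderiv_fun_id]

/-- In the coordinates `w ↦ x * loc n G w` the coefficients of a left-invariant field are given by
`frame` and do not depend on `x`. This is why commutators are again left-invariant. -/
theorem lieDeriv_mul_loc (X : GroupLieAlgebra (𝓡 n) G) {f : G → F} (hf : IsSmooth n f) (x : G)
    {u : EuclideanSpace ℝ (Fin n)} (hu : u ∈ dom n G) :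
    lieDeriv X f (x * loc n G u) =
      fderiv ℝ (fun w => f (x * loc n G w)) u (frame n G u (coord X)) := by
  rw [lieDeriv_eq_fderiv X (hf.mdifferentiableAt _)]
  have hev : (fun v => f (x * loc n G u * loc n G v)) =ᶠ[𝓝 (origin n G)]
      (fun w => f (x * loc n G w)) ∘
        fun v => extChartAt (𝓡 n) (1 : G) (loc n G u * loc n G v) := by
    have hc : ContinuousAt (fun v => loc n G u * loc n G v) (origin n G) :=
      ((contMDiffAt_const (c := loc n G u)).mul
        (contMDiffAt_loc origin_mem_dom)).continuousAt
    have : (extChartAt (𝓡 n) (1 : G)).source ∈ 𝓝 (loc n G u * loc n G (origin n G)) := by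
      rw [loc_origin, mul_one]
      exact (isOpen_extChartAt_source (I := 𝓡 n) (1 : G)).mem_nhds (loc_mem_source hu)
    filter_upwards [hc this] with v hv
    simp only [Function.comp_apply, loc] at hv ⊢
    rw [(extChartAt (𝓡 n) (1 : G)).left_inv hv, mul_assoc]
  have hval : extChartAt (𝓡 n) (1 : G) (loc n G u * loc n G (origin n G)) = u := by
    rw [loc_origin, mul_one, extChartAt_loc hu]
  have hd : DifferentiableAt ℝ (fun w => f (x * loc n G w))
      (extChartAt (𝓡 n) (1 : G) (loc n G u * loc n G (origin n G))) := by
    rw [hval]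
    exact (hf.contDiffAt_loc x hu).differentiableAt (by simp)
  rw [hev.fderiv_eq, fderiv_comp (origin n G) hd (differentiableAt_frame_aux hu), hval]
  rfl

/-- The commutator of two left-invariant vector fields is a left-invariant vector field. -/
theorem exists_lieDeriv_commutator (X Y : GroupLieAlgebra (𝓡 n) G) :
    ∃ Z : GroupLieAlgebra (𝓡 n) G, ∀ f : G → ℂ, IsSmooth n f →
      lieDeriv X (lieDeriv Y f) - lieDeriv Y (lieDeriv X f) = lieDeriv Z f := by
  -- `B X Y` is the derivative of the coefficients of `Y` in the direction `X` at the origin. In the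
  -- commutator the second derivatives of `f` cancel by symmetry and only `B X Y - B Y X` remains, a
  -- vector independent of `x` and `f`.
  let B : EuclideanSpace ℝ (Fin n) → EuclideanSpace ℝ (Fin n) → EuclideanSpace ℝ (Fin n) :=
    fun X Y => fderiv ℝ (fun u => frame n G u Y) (origin n G) X
  refine ⟨coord.symm (B (coord X) (coord Y) - B (coord Y) (coord X)), fun f hf => ?_⟩
  ext x
  have hsm := hf.contDiffAt_loc x (origin_mem_dom (n := n) (G := G))
  have hd : DifferentiableAt ℝ (fderiv ℝ fun w => f (x * loc n G w)) (origin n G) :=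
    (hsm.fderiv_right (m := 1) (by norm_cast)).differentiableAt (by simp)
  have hfr : DifferentiableAt ℝ (frame n G) (origin n G) :=
    (contDiffAt_frame origin_mem_dom).differentiableAt (by simp)
  have key : ∀ X Y : GroupLieAlgebra (𝓡 n) G,
      lieDeriv X (lieDeriv Y f) x =
      fderiv ℝ (fderiv ℝ fun w => f (x * loc n G w)) (origin n G) (coord X) (coord Y)
        + fderiv ℝ (fun w => f (x * loc n G w)) (origin n G) (B (coord X) (coord Y)) := by
    intro X Y
    rw [lieDeriv_eq_fderiv _ ((hf.lieDeriv _).mdifferentiableAt x)]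
    have hev : (fun u => lieDeriv Y f (x * loc n G u)) =ᶠ[𝓝 (origin n G)]
        fun u => fderiv ℝ (fun w => f (x * loc n G w)) u (frame n G u (coord Y)) := by
      filter_upwards [dom_mem_nhds (n := n) (G := G)] with u hu
      exact lieDeriv_mul_loc _ hf x hu
    have hfrY : DifferentiableAt ℝ (fun u => frame n G u (coord Y)) (origin n G) :=
      hfr.clm_apply (differentiableAt_const _)
    rw [hev.fderiv_eq, fderiv_clm_apply hd hfrY]
    simp only [add_apply, ContinuousLinearMap.coe_comp, Function.comp_apply,
      ContinuousLinearMap.flip_apply, frame_origin, ContinuousLinearMap.id_apply]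
    rw [add_comm]
  have hsymm : IsSymmSndFDerivAt ℝ (fun w => f (x * loc n G w)) (origin n G) :=
    hsm.isSymmSndFDerivAt (by rw [minSmoothness_of_isRCLikeNormedField]; norm_cast)
  rw [Pi.sub_apply, lieDeriv_eq_fderiv _ (hf.mdifferentiableAt x), key, key,
    LinearEquiv.apply_symm_apply, map_sub, hsymm.eq (coord X) (coord Y)]
  ring

end Commutator

/-! ### Reordering words: the spanning half of Poincaré–Birkhoff–Witt. -/

section Reordering

variable {R ι : Type*} [Ring R] [Algebra ℝ R]

/-- The span of the products of at most `m` of the elements `x i`. -/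
def wordSpan (x : ι → R) (m : ℕ) : Submodule ℝ R :=
  Submodule.span ℝ {r | ∃ w : List ι, w.length ≤ m ∧ r = (w.map x).prod}

theorem wordSpan_mono (x : ι → R) {m m' : ℕ} (h : m ≤ m') : wordSpan x m ≤ wordSpan x m' :=
  Submodule.span_mono fun _ ⟨w, hw, hr⟩ => ⟨w, hw.trans h, hr⟩

theorem prod_mem_wordSpan (x : ι → R) {w : List ι} {m : ℕ} (h : w.length ≤ m) :
    (w.map x).prod ∈ wordSpan x m := Submodule.subset_span ⟨w, h, rfl⟩

theorem mul_mem_wordSpan (x : ι → R) (i : ι) {m : ℕ} {r : R} (hr : r ∈ wordSpan x m) :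
    x i * r ∈ wordSpan x (m + 1) := by
  induction hr using Submodule.span_induction with
  | mem r hr =>
    obtain ⟨w, hw, rfl⟩ := hr
    exact prod_mem_wordSpan x (w := i :: w) (by simpa using hw)
  | zero => simp
  | add r s _ _ hr hs => rw [mul_add]; exact add_mem hr hs
  | smul c r _ hr => rw [mul_smul_comm]; exact Submodule.smul_mem _ _ hr

theorem span_mul_mem_wordSpan (x : ι → R) {m : ℕ} {s r : R}
    (hs : s ∈ Submodule.span ℝ (range x)) (hr : r ∈ wordSpan x m) :
    s * r ∈ wordSpan x (m + 1) := by
  induction hs using Submodule.span_induction with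
  | mem s hs =>
    obtain ⟨i, rfl⟩ := hs
    exact mul_mem_wordSpan x i hr
  | zero => simp
  | add r s _ _ hr hs => rw [add_mul]; exact add_mem hr hs
  | smul c r _ hr => rw [smul_mul_assoc]; exact Submodule.smul_mem _ _ hr

/-- If the commutators of the `x i` are linear combinations of the `x i`, then permuting the
factors of a product changes it by a combination of shorter products. -/
theorem prod_sub_prod_mem_wordSpan_of_perm {x : ι → R}
    (hx : ∀ i j, x i * x j - x j * x i ∈ Submodule.span ℝ (range x)) {l l' : List ι}
    (h : l.Perm l') : (l.map x).prod - (l'.map x).prod ∈ wordSpan x (l.length - 1) := by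
  induction h with
  | nil => simp
  | @cons i l l' h ih =>
    -- The empty tail is treated apart because `l.length - 1` is truncated: only for nonempty `l`
    -- does `l.length - 1 + 1` return `l.length`.
    rcases l with _ | ⟨j, l⟩
    · rw [List.nil_perm.1 h]; simp
    · have := mul_mem_wordSpan x i ih
      simpa [mul_sub] using this
  | swap i j l =>
    have := span_mul_mem_wordSpan x (hx j i) (prod_mem_wordSpan x (le_refl l.length))
    simpa [sub_mul, mul_assoc] using this
  | trans h₁ _ ih₁ ih₂ =>
    rw [← h₁.length_eq] at ih₂
    simpa using add_mem ih₁ ih₂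

/-- The nondecreasing list of indices with the given multiplicities. -/
def orderedWord {n : ℕ} (α : Fin n → ℕ) : List (Fin n) :=
  (List.ofFn fun i => List.replicate (α i) i).flatten

theorem count_orderedWord {n : ℕ} (α : Fin n → ℕ) (j : Fin n) :
    (orderedWord α).count j = α j := by
  rw [orderedWord, List.count_flatten, List.map_ofFn, List.sum_ofFn]
  simp [List.count_replicate]

theorem perm_orderedWord {n : ℕ} (w : List (Fin n)) : w.Perm (orderedWord fun i => w.count i) :=
  List.perm_iff_count.2 fun j => (count_orderedWord (fun i => w.count i) j).symm

/-- The multi-indices of length `n` and order at most `k`. -/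
def multiIdx (n k : ℕ) : Finset (Fin n → ℕ) :=
  (Fintype.piFinset fun _ => Finset.range (k + 1)).filter fun α => ∑ i, α i ≤ k

theorem mem_multiIdx {n k : ℕ} {α : Fin n → ℕ} : α ∈ multiIdx n k ↔ ∑ i, α i ≤ k := by
  simp only [multiIdx, Finset.mem_filter, Fintype.mem_piFinset, Finset.mem_range, Nat.lt_succ_iff,
    and_iff_right_iff_imp]
  exact fun h i => (Finset.single_le_sum (fun _ _ => Nat.zero_le _) (Finset.mem_univ i)).trans h

theorem length_orderedWord {n : ℕ} (α : Fin n → ℕ) : (orderedWord α).length = ∑ i, α i := by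
  rw [orderedWord, List.length_flatten, List.map_ofFn, List.sum_ofFn]
  simp

/-- Sorting a word costs only shorter words, which are combinations of ordered ones by induction on
the length. -/
theorem wordSpan_le_span_orderedWord {n : ℕ} {x : Fin n → R}
    (hx : ∀ i j, x i * x j - x j * x i ∈ Submodule.span ℝ (range x)) (m : ℕ) :
    wordSpan x m ≤ Submodule.span ℝ
      ((fun α => ((orderedWord α).map x).prod) '' (multiIdx n m : Set (Fin n → ℕ))) := by
  have key : ∀ (w : List (Fin n)), w.length ≤ m →
      ((orderedWord fun i => w.count i).map x).prod ∈ Submodule.span ℝ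
      ((fun α => ((orderedWord α).map x).prod) '' (multiIdx n m : Set (Fin n → ℕ))) := by
    intro w hw
    refine Submodule.subset_span ⟨_, ?_, rfl⟩
    rw [Finset.mem_coe, mem_multiIdx, ← length_orderedWord, ← (perm_orderedWord w).length_eq]
    exact hw
  induction m with
  | zero =>
    refine Submodule.span_le.2 ?_
    rintro _ ⟨w, hw, rfl⟩
    have : w = [] := by simpa using hw
    subst this
    simpa [orderedWord] using key [] le_rfl
  | succ m ih =>
    refine Submodule.span_le.2 ?_
    rintro _ ⟨w, hw, rfl⟩
    have h1 := prod_sub_prod_mem_wordSpan_of_perm hx (perm_orderedWord w)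
    have h2 := ih (fun w hw => Submodule.subset_span ⟨_, by
      rw [Finset.mem_coe, mem_multiIdx, ← length_orderedWord, ← (perm_orderedWord w).length_eq]
      exact hw, rfl⟩) (wordSpan_mono x (by omega : w.length - 1 ≤ m) h1)
    have h3 := Submodule.span_mono (image_mono (f := fun α => ((orderedWord α).map x).prod)
      (show (multiIdx n m : Set (Fin n → ℕ)) ⊆ multiIdx n (m + 1) from fun α hα => by
        rw [Finset.mem_coe, mem_multiIdx] at hα ⊢; omega)) h2
    simpa using add_mem h3 (key w hw)

end Reordering

/-! ### Left-invariant differential operators as an algebra of endomorphisms of smooth functions. -/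

section

variable {n : ℕ} {G : Type*} [Group G] [TopologicalSpace G]
  [ChartedSpace (EuclideanSpace ℝ (Fin n)) G] [LieGroup (𝓡 n) ∞ G]

theorem SmoothFun.isSmooth (f : SmoothFun n G) : IsSmooth n (f : G → ℂ) := f.contMDiff

/-- The derivation of `C^∞(G)` given by an element of the Lie algebra. -/
def lieDerivEnd (X : GroupLieAlgebra (𝓡 n) G) : Module.End ℝ (SmoothFun n G) where
  toFun f := ⟨lieDeriv X f, (SmoothFun.isSmooth f).lieDeriv X⟩
  map_add' f g := by
    ext x
    exact congrFun (lieDeriv_add X (SmoothFun.isSmooth f) (SmoothFun.isSmooth g)) x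
  map_smul' c f := by
    ext x
    exact congrFun (lieDeriv_clm_comp X (SmoothFun.isSmooth f)
      (c • ContinuousLinearMap.id ℝ ℂ)) x

theorem coe_prod_lieDerivEnd (L : List (GroupLieAlgebra (𝓡 n) G)) (f : SmoothFun n G) :
    ⇑((L.map lieDerivEnd).prod f) = iterLieDeriv L f := by
  induction L with
  | nil => rfl
  | cons X L ih =>
    rw [List.map_cons, List.prod_cons, iterLieDeriv_cons, ← ih]
    rfl

theorem lieDerivEnd_add (X Y : GroupLieAlgebra (𝓡 n) G) :
    lieDerivEnd (X + Y) = lieDerivEnd X + lieDerivEnd Y := by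
  ext f x
  exact congrFun (lieDeriv_add_vec X Y f) x

theorem lieDerivEnd_smul (c : ℝ) (X : GroupLieAlgebra (𝓡 n) G) :
    lieDerivEnd (c • X) = c • lieDerivEnd X := by
  ext f x
  exact congrFun (lieDeriv_smul_vec c X f) x

/-- `lieDerivEnd` as a linear map. -/
def lieDerivHom : GroupLieAlgebra (𝓡 n) G →ₗ[ℝ] Module.End ℝ (SmoothFun n G) where
  toFun := lieDerivEnd
  map_add' := lieDerivEnd_add
  map_smul' := lieDerivEnd_smul

theorem lieDerivEnd_mem_span (b : Module.Basis (Fin n) ℝ (GroupLieAlgebra (𝓡 n) G))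
    (X : GroupLieAlgebra (𝓡 n) G) :
    lieDerivEnd X ∈ Submodule.span ℝ (range fun i => lieDerivEnd (b i)) := by
  have h : X ∈ Submodule.span ℝ (range b) := by rw [b.span_eq]; trivial
  have := Submodule.mem_map_of_mem (f := lieDerivHom) h
  rwa [Submodule.map_span, ← range_comp] at this

/-- A derivative along a word in the basis vectors is a linear combination of derivatives along
ordered monomials. -/
theorem exists_iterLieDeriv_eq_sum_multiLieDeriv
    (b : Module.Basis (Fin n) ℝ (GroupLieAlgebra (𝓡 n) G)) {k : ℕ} (w : List (Fin n))
    (hw : w.length ≤ k) :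
    ∃ c : (Fin n → ℕ) → ℝ, ∀ (f : G → ℂ), IsSmooth n f → ∀ x,
      iterLieDeriv (w.map b) f x = ∑ α ∈ multiIdx n k, c α • multiLieDeriv b α f x := by
  -- In the endomorphism algebra words in the fields are genuine products, so the commutator theorem
  -- supplies the hypothesis of the reordering lemma. The coefficients obtained there depend on
  -- neither `f` nor `x`.
  have hcomm : ∀ i j, lieDerivEnd (b i) * lieDerivEnd (b j) - lieDerivEnd (b j) * lieDerivEnd (b i)
      ∈ Submodule.span ℝ (range fun i => lieDerivEnd (b i)) := by
    intro i j
    obtain ⟨Z, hZ⟩ := exists_lieDeriv_commutator (b i) (b j)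
    have : lieDerivEnd (b i) * lieDerivEnd (b j) - lieDerivEnd (b j) * lieDerivEnd (b i)
        = lieDerivEnd Z := by
      ext f x
      exact congrFun (hZ f (SmoothFun.isSmooth f)) x
    rw [this]
    exact lieDerivEnd_mem_span b Z
  have h := wordSpan_le_span_orderedWord hcomm k
    (prod_mem_wordSpan (fun i => lieDerivEnd (b i)) hw)
  obtain ⟨c, hc⟩ := (Submodule.mem_span_image_finset_iff_exists_fun' ℝ).1 h
  refine ⟨c, fun f hf x => ?_⟩
  obtain ⟨φ, rfl⟩ : ∃ φ : SmoothFun n G, (φ : G → ℂ) = f := ⟨⟨f, hf⟩, rfl⟩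
  have h1 := coe_prod_lieDerivEnd (w.map b) φ
  have h2 : ∀ α : Fin n → ℕ, multiLieDeriv b α φ =
      ⇑(((orderedWord α).map fun i => lieDerivEnd (b i)).prod φ) := by
    intro α
    have := coe_prod_lieDerivEnd ((orderedWord α).map b) φ
    rw [List.map_map] at this
    refine Eq.trans ?_ this.symm
    rw [multiLieDeriv]
    congr 1
    simp [orderedWord, List.map_flatten, List.map_ofFn, Function.comp_def]
  rw [List.map_map] at h1
  refine (congrFun h1.symm x).trans ?_
  have h3 := congrArg (fun T : Module.End ℝ (SmoothFun n G) => T φ x) hc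
  refine h3.symm.trans ?_
  simp only [h2, LinearMap.sum_apply, LinearMap.smul_apply]
  rw [← ContMDiffMap.coeFnAddMonoidHom_apply, map_sum, Finset.sum_apply]
  rfl

end

/-! ### The Sobolev inequality on Euclidean space by Fourier transform. -/

section EuclideanSobolev

open scoped SchwartzMap LineDeriv FourierTransform

variable {n : ℕ}

theorem norm_fourier_iterate_lineDeriv (e : EuclideanSpace ℝ (Fin n)) (m : ℕ)
    (u : 𝓢(EuclideanSpace ℝ (Fin n), ℂ)) (ξ : EuclideanSpace ℝ (Fin n)) :
    ‖𝓕 ((fun v : 𝓢(EuclideanSpace ℝ (Fin n), ℂ) => ∂_{e} v)^[m] u) ξ‖ =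
      (2 * Real.pi * |inner ℝ ξ e|) ^ m * ‖𝓕 u ξ‖ := by
  induction m with
  | zero => simp
  | succ m ih =>
    have ht : (inner ℝ · e : EuclideanSpace ℝ (Fin n) → ℝ).HasTemperateGrowth := by fun_prop
    rw [Function.iterate_succ_apply', SchwartzMap.fourier_lineDerivOp_eq, smul_apply,
      SchwartzMap.smulLeftCLM_apply_apply ht, norm_smul, norm_smul, ih]
    simp only [norm_mul, Complex.norm_real, Complex.norm_I, Real.norm_eq_abs, Complex.norm_ofNat,
      abs_of_pos Real.pi_pos]
    ring

/-- The power mean inequality for the `n + 1` numbers `1, ξ₁², …, ξₙ²`. It allows the Sobolev norm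
to be controlled by the pure derivatives `∂ᵢ^k` alone. -/
theorem one_add_norm_sq_pow_le (m : ℕ) (ξ : EuclideanSpace ℝ (Fin n)) :
    (1 + ‖ξ‖ ^ 2) ^ m ≤ ((n : ℝ) + 1) ^ m * (1 + ∑ i, |ξ i| ^ (2 * m)) := by
  rcases m with _ | m
  · simp
  have h := pow_sum_div_card_le_sum_pow (s := (Finset.univ : Finset (Option (Fin n))))
    (f := fun o => o.elim (1 : ℝ) fun i => ξ i ^ 2)
    (fun o _ => by cases o <;> simp [sq_nonneg]) m
  rw [div_le_iff₀' (by positivity)] at h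
  simp only [Fintype.sum_option, Option.elim_none, Option.elim_some, Finset.card_univ,
    Fintype.card_option, Fintype.card_fin, one_pow] at h
  rw [EuclideanSpace.real_norm_sq_eq]
  refine h.trans ?_
  push_cast
  have : ∀ i, (ξ i ^ 2) ^ (m + 1) = |ξ i| ^ (2 * (m + 1)) := fun i => by
    rw [← sq_abs, ← pow_mul]
  simp only [this]
  gcongr
  · linarith [(Nat.cast_nonneg n : (0 : ℝ) ≤ n)]
  · exact Nat.le_succ m

theorem integrable_norm_sq_schwartz (u : 𝓢(EuclideanSpace ℝ (Fin n), ℂ)) :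
    Integrable (fun x => ‖u x‖ ^ 2) := (u.memLp 2).integrable_norm_pow (by simp)

/-- The Sobolev inequality on Euclidean space, for Schwartz functions. -/
theorem exists_sobolev_schwartz {k : ℕ} (hk : (n : ℝ) / 2 < k) :
    ∃ C : ℝ, 0 ≤ C ∧ ∀ (u : 𝓢(EuclideanSpace ℝ (Fin n), ℂ)) (x : EuclideanSpace ℝ (Fin n)),
      ‖u x‖ ^ 2 ≤ C * ((∫ y, ‖u y‖ ^ 2) + ∑ i : Fin n, ∫ y,
        ‖((fun v : 𝓢(EuclideanSpace ℝ (Fin n), ℂ) =>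
          ∂_{EuclideanSpace.single i (1 : ℝ)} v)^[k] u) y‖ ^ 2) := by
  have h_int : Integrable
      (fun ξ : EuclideanSpace ℝ (Fin n) => ((1 : ℝ) + ‖ξ‖ ^ 2) ^ (-(k : ℝ))) := by
    have := integrable_rpow_neg_one_add_norm_sq (E := EuclideanSpace ℝ (Fin n)) (μ := volume)
      (r := 2 * k) (by simp; linarith)
    convert this using 3
    ring
  refine ⟨(∫ ξ : EuclideanSpace ℝ (Fin n), ((1 : ℝ) + ‖ξ‖ ^ 2) ^ (-(k : ℝ))) * ((n : ℝ) + 1) ^ k,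
    by positivity, fun u x => ?_⟩
  set v : Fin n → 𝓢(EuclideanSpace ℝ (Fin n), ℂ) := fun i =>
    (fun v : 𝓢(EuclideanSpace ℝ (Fin n), ℂ) => ∂_{EuclideanSpace.single i (1 : ℝ)} v)^[k] u with hv
  have hpt : ∀ ξ, (1 + ‖ξ‖ ^ 2) ^ k * ‖𝓕 u ξ‖ ^ 2 ≤
      ((n : ℝ) + 1) ^ k * (‖𝓕 u ξ‖ ^ 2 + ∑ i, ‖𝓕 (v i) ξ‖ ^ 2) := by
    intro ξ
    refine (mul_le_mul_of_nonneg_right (one_add_norm_sq_pow_le k ξ) (sq_nonneg _)).trans ?_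
    rw [mul_assoc, add_mul, one_mul, Finset.sum_mul]
    gcongr with i
    rw [hv, norm_fourier_iterate_lineDeriv, mul_pow, ← pow_mul, mul_comm k 2]
    gcongr
    rw [EuclideanSpace.inner_single_right]
    simp only [one_mul, conj_trivial]
    have : 1 ≤ 2 * Real.pi := by linarith [Real.pi_gt_three]
    nlinarith [abs_nonneg (ξ i)]
  have hRint : Integrable fun ξ => ((n : ℝ) + 1) ^ k * (‖𝓕 u ξ‖ ^ 2 + ∑ i, ‖𝓕 (v i) ξ‖ ^ 2) :=
    ((integrable_norm_sq_schwartz _).add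
      (integrable_finsetSum _ fun i _ => integrable_norm_sq_schwartz _)).const_mul _
  have hcont : Continuous fun ξ => (1 + ‖ξ‖ ^ 2) ^ k * ‖𝓕 u ξ‖ ^ 2 := by
    have := (𝓕 u).continuous
    fun_prop
  have hLint : Integrable fun ξ => (1 + ‖ξ‖ ^ 2) ^ k * ‖𝓕 u ξ‖ ^ 2 :=
    hRint.mono' hcont.aestronglyMeasurable (Eventually.of_forall fun ξ => by
      rw [Real.norm_of_nonneg (by positivity)]; exact hpt ξ)
  have hJ : ∫ ξ, (1 + ‖ξ‖ ^ 2) ^ k * ‖𝓕 u ξ‖ ^ 2 ≤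
      ((n : ℝ) + 1) ^ k * ((∫ y, ‖u y‖ ^ 2) + ∑ i, ∫ y, ‖v i y‖ ^ 2) := by
    refine (integral_mono hLint hRint hpt).trans_eq ?_
    rw [integral_const_mul, integral_add (integrable_norm_sq_schwartz _)
      (integrable_finsetSum _ fun i _ => integrable_norm_sq_schwartz _),
      integral_finsetSum _ fun i _ => integrable_norm_sq_schwartz _]
    simp only [SchwartzMap.integral_norm_sq_fourier]
  have h1 : ‖u x‖ ≤ ∫ ξ, ‖𝓕 u ξ‖ := by
    have : u x = 𝓕⁻ (𝓕 u) x := by rw [FourierTransform.fourierInv_fourier_eq]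
    rw [this, SchwartzMap.fourierInv_coe, Real.fourierInv_eq]
    refine (norm_integral_le_integral_norm _).trans_eq ?_
    simp
  -- Cauchy–Schwarz for `‖𝓕 u‖ = a * c`: the square of `a` is integrable exactly because `2k > n`,
  -- and the integral of the square of `c` is the Sobolev norm bounded in `hJ`.
  set a : EuclideanSpace ℝ (Fin n) → ℝ := fun ξ => (1 + ‖ξ‖ ^ 2) ^ (-(k : ℝ) / 2) with ha
  set c : EuclideanSpace ℝ (Fin n) → ℝ := fun ξ => (1 + ‖ξ‖ ^ 2) ^ ((k : ℝ) / 2) * ‖𝓕 u ξ‖ with hc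
  have ha2 : ∀ ξ, a ξ ^ 2 = (1 + ‖ξ‖ ^ 2) ^ (-(k : ℝ)) := fun ξ => by
    rw [ha, ← Real.rpow_mul_natCast (by positivity)]; simp
  have hc2 : ∀ ξ, c ξ ^ 2 = (1 + ‖ξ‖ ^ 2) ^ k * ‖𝓕 u ξ‖ ^ 2 := fun ξ => by
    rw [hc, mul_pow, ← Real.rpow_mul_natCast (by positivity)]; simp
  have hac : ∀ ξ, ‖𝓕 u ξ‖ = a ξ * c ξ := fun ξ => by
    rw [ha, hc, ← mul_assoc, ← Real.rpow_add (by positivity)]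
    simp [neg_div]
  have hacont : Continuous a := by
    refine Continuous.rpow_const (by fun_prop) fun ξ => Or.inl (by positivity)
  have hccont : Continuous c := by
    have := (𝓕 u).continuous
    exact (Continuous.rpow_const (by fun_prop) fun ξ => Or.inl (by positivity)).mul this.norm
  have haL : MemLp a (ENNReal.ofReal 2) := by
    rw [ENNReal.ofReal_ofNat, memLp_two_iff_integrable_sq hacont.aestronglyMeasurable]
    simpa only [ha2] using h_int
  have hcL : MemLp c (ENNReal.ofReal 2) := by
    rw [ENNReal.ofReal_ofNat, memLp_two_iff_integrable_sq hccont.aestronglyMeasurable]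
    simpa only [hc2] using hLint
  have hcs := integral_mul_le_Lp_mul_Lq_of_nonneg Real.HolderConjugate.two_two
    (μ := volume) (f := a) (g := c)
    (Eventually.of_forall fun ξ => by simp only [ha, Pi.zero_apply]; positivity)
    (Eventually.of_forall fun ξ => by simp only [hc, Pi.zero_apply]; positivity) haL hcL
  simp only [Real.rpow_two, ← hac, ha2, hc2, ← Real.sqrt_eq_rpow] at hcs
  have h2 := h1.trans hcs
  have h3 := pow_le_pow_left₀ (norm_nonneg _) h2 2
  rw [mul_pow, Real.sq_sqrt (integral_nonneg fun ξ => by positivity),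
    Real.sq_sqrt (integral_nonneg fun ξ => by positivity)] at h3
  refine h3.trans ?_
  rw [mul_assoc]
  exact mul_le_mul_of_nonneg_left hJ (integral_nonneg fun ξ => by positivity)

end EuclideanSobolev

/-! ### Localisation in the chart and the Sobolev inequality near the identity. -/

section LocalSobolev

open scoped SchwartzMap LineDeriv

/-- Smooth functions supported in `K`. -/
structure Cut {E : Type*} [NormedAddCommGroup E] [NormedSpace ℝ E] (K : Set E) where
  toFun : E → ℂ
  contDiff' : ContDiff ℝ ∞ toFun
  tsupport_subset_compact : tsupport toFun ⊆ K

section Cut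

variable {E : Type*} [NormedAddCommGroup E] [NormedSpace ℝ E] {K : Set E}

/-- The product with a function that is smooth near `K`. -/
def Cut.mul (c : Cut K) (a : E → ℂ) (ha : ∀ u ∈ K, ContDiffAt ℝ ∞ a u) : Cut K where
  toFun u := c.toFun u * a u
  contDiff' := contMDiff_iff_contDiff.1 <| contMDiff_of_tsupport fun u hu =>
    (c.contDiff'.contDiffAt.mul
      (ha u (c.tsupport_subset_compact (tsupport_mul_subset_left hu)))).contMDiffAt
  tsupport_subset_compact := tsupport_mul_subset_left.trans c.tsupport_subset_compact

/-- The derivative in a direction. -/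
def Cut.deriv (c : Cut K) (e : E) : Cut K where
  toFun u := fderiv ℝ c.toFun u e
  contDiff' := (c.contDiff'.fderiv_right (m := ∞) (by simp)).clm_apply contDiff_const
  tsupport_subset_compact := (tsupport_fderiv_apply_subset ℝ e).trans c.tsupport_subset_compact

/-- A smooth function with compact support as a Schwartz function. -/
def Cut.toSchwartz (hK : IsCompact K) (c : Cut K) : 𝓢(E, ℂ) :=
  HasCompactSupport.toSchwartzMap
    (HasCompactSupport.of_support_subset_isCompact hK
      ((subset_tsupport _).trans c.tsupport_subset_compact))
    c.contDiff'

theorem Cut.toSchwartz_apply (hK : IsCompact K) (c : Cut K) (u : E) :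
    c.toSchwartz hK u = c.toFun u := rfl

theorem Cut.eq_zero (c : Cut K) {u : E} (hu : u ∉ K) : c.toFun u = 0 :=
  image_eq_zero_of_notMem_tsupport fun h => hu (c.tsupport_subset_compact h)

theorem Cut.fderiv_eq_zero (c : Cut K) {u : E} (hu : u ∉ K) : fderiv ℝ c.toFun u = 0 :=
  image_eq_zero_of_notMem_tsupport fun h => hu (c.tsupport_subset_compact (tsupport_fderiv_subset ℝ h))

end Cut

theorem tsupport_iterate_lineDeriv_subset {E : Type*} [NormedAddCommGroup E] [NormedSpace ℝ E]
    (e : E) (m : ℕ) (u : 𝓢(E, ℂ)) :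
    tsupport ((fun v : 𝓢(E, ℂ) => ∂_{e} v)^[m] u) ⊆ tsupport u := by
  induction m with
  | zero => rfl
  | succ m ih =>
    rw [Function.iterate_succ_apply']
    exact (SchwartzMap.tsupport_lineDerivOp_subset e _).trans ih

theorem iterate_lineDeriv_add_sum {E ι : Type*} [NormedAddCommGroup E] [NormedSpace ℝ E]
    (e : E) (m : ℕ) (u : 𝓢(E, ℂ)) (s : Finset ι) (v : ι → 𝓢(E, ℂ)) :
    (fun v : 𝓢(E, ℂ) => ∂_{e} v)^[m] (u + ∑ i ∈ s, v i) =
      (fun v : 𝓢(E, ℂ) => ∂_{e} v)^[m] u + ∑ i ∈ s, (fun v : 𝓢(E, ℂ) => ∂_{e} v)^[m] (v i) := by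
  induction m with
  | zero => rfl
  | succ m ih =>
    simp only [Function.iterate_succ_apply', ih, LineDeriv.lineDerivOp_add,
      LineDeriv.lineDerivOp_sum]

variable {n : ℕ} {G : Type*} [Group G] [TopologicalSpace G]
  [ChartedSpace (EuclideanSpace ℝ (Fin n)) G] [LieGroup (𝓡 n) ∞ G]
  (b : Module.Basis (Fin n) ℝ (GroupLieAlgebra (𝓡 n) G))

theorem multiLieDeriv_zero (f : G → ℂ) : multiLieDeriv b 0 f = f := by
  have : (List.ofFn fun i : Fin n => List.replicate ((0 : Fin n → ℕ) i) (b i)).flatten = [] := by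
    simp
  rw [multiLieDeriv, this, iterLieDeriv_nil]

theorem multiLieDeriv_eq_iterLieDeriv (α : Fin n → ℕ) (f : G → ℂ) :
    multiLieDeriv b α f = iterLieDeriv ((orderedWord α).map b) f := by
  rw [multiLieDeriv]
  congr 1
  simp [orderedWord, List.map_flatten, List.map_ofFn, Function.comp_def]

/-- Appending `b j` to an ordered monomial spoils the order; reordering restores it with
coefficients that are uniform in `f` and `x`. -/
theorem exists_sum_norm_multiLieDeriv_lieDeriv_le (j : Fin n) (m : ℕ) :
    ∃ C : ℝ, 0 ≤ C ∧ ∀ f : G → ℂ, IsSmooth n f → ∀ x,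
      ∑ α ∈ multiIdx n m, ‖multiLieDeriv b α (lieDeriv (b j) f) x‖ ≤
        C * ∑ β ∈ multiIdx n (m + 1), ‖multiLieDeriv b β f x‖ := by
  have h : ∀ α : Fin n → ℕ, ∃ c : (Fin n → ℕ) → ℝ, α ∈ multiIdx n m →
      ∀ f : G → ℂ, IsSmooth n f → ∀ x, multiLieDeriv b α (lieDeriv (b j) f) x =
        ∑ β ∈ multiIdx n (m + 1), c β • multiLieDeriv b β f x := by
    intro α
    by_cases hα : α ∈ multiIdx n m
    · obtain ⟨c, hc⟩ := exists_iterLieDeriv_eq_sum_multiLieDeriv b (k := m + 1)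
        (orderedWord α ++ [j]) (by
          rw [mem_multiIdx] at hα
          simpa [length_orderedWord] using hα)
      refine ⟨c, fun _ f hf x => ?_⟩
      rw [← hc f hf x, List.map_append, iterLieDeriv_append, multiLieDeriv_eq_iterLieDeriv]
      rfl
    · exact ⟨0, fun h => absurd h hα⟩
  choose c hc using h
  refine ⟨∑ α ∈ multiIdx n m, ∑ β ∈ multiIdx n (m + 1), |c α β|, by positivity,
    fun f hf x => ?_⟩
  rw [Finset.sum_mul]
  refine Finset.sum_le_sum fun α hα => ?_
  rw [hc α hα f hf x, Finset.sum_mul]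
  refine (norm_sum_le _ _).trans (Finset.sum_le_sum fun β hβ => ?_)
  rw [norm_smul, Real.norm_eq_abs]
  refine mul_le_mul_of_nonneg_left ?_ (abs_nonneg _)
  exact Finset.single_le_sum (f := fun β => ‖multiLieDeriv b β f x‖)
    (fun _ _ => norm_nonneg _) hβ

theorem IsSmooth.contDiffAt_comp_loc {F : G → ℂ} (hF : IsSmooth n F)
    {u : EuclideanSpace ℝ (Fin n)} (hu : u ∈ dom n G) :
    ContDiffAt ℝ ∞ (fun u => F (loc n G u)) u := by
  simpa only [one_mul] using hF.contDiffAt_loc 1 hu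

variable {K : Set (EuclideanSpace ℝ (Fin n))}

/-- The product of a cutoff function with a function on the group, in the chart. -/
def localize (hK : IsCompact K) (hKdom : K ⊆ dom n G) (c : Cut K) (F : G → ℂ)
    (hF : IsSmooth n F) : 𝓢(EuclideanSpace ℝ (Fin n), ℂ) :=
  (c.mul (fun u => F (loc n G u)) fun _ hu => hF.contDiffAt_comp_loc (hKdom hu)).toSchwartz hK

/-- The coefficients of a constant vector field in the left-invariant frame. -/
def frameCoeff (e : EuclideanSpace ℝ (Fin n)) (j : Fin n) (u : EuclideanSpace ℝ (Fin n)) : ℂ :=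
  (((b.map coord).coord j (Ring.inverse (frame n G u) e) : ℝ) : ℂ)

theorem contDiffAt_frameCoeff (e : EuclideanSpace ℝ (Fin n)) (j : Fin n)
    {u : EuclideanSpace ℝ (Fin n)} (hu : u ∈ dom n G) (hu' : IsUnit (frame n G u)) :
    ContDiffAt ℝ ∞ (frameCoeff b e j) u := by
  obtain ⟨U, hU⟩ := hu'
  have h1 : ContDiffAt ℝ ∞ (fun u => Ring.inverse (frame n G u)) u := by
    have h := contDiffAt_ringInverse ℝ (n := ∞) U
    rw [hU] at h
    exact h.comp u (contDiffAt_frame hu)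
  have h2 : ContDiffAt ℝ ∞ (fun u => Ring.inverse (frame n G u) e) u :=
    h1.clm_apply contDiffAt_const
  have h3 := (Complex.ofRealCLM.contDiff (n := ∞)).comp
    ((LinearMap.toContinuousLinearMap ((b.map coord).coord j)).contDiff (n := ∞))
  exact h3.contDiffAt.comp u h2

/-- Where the frame is invertible, a constant vector `e` is a combination of the left-invariant
fields, with coefficients read off from the inverse of the frame. -/
theorem fderiv_comp_loc {F : G → ℂ} (hF : IsSmooth n F) (e : EuclideanSpace ℝ (Fin n))
    {u : EuclideanSpace ℝ (Fin n)} (hu : u ∈ dom n G) (hu' : IsUnit (frame n G u)) :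
    fderiv ℝ (fun u => F (loc n G u)) u e =
      ∑ j, frameCoeff b e j u * lieDeriv (b j) F (loc n G u) := by
  have h1 : ∀ j, lieDeriv (b j) F (loc n G u) =
      fderiv ℝ (fun u => F (loc n G u)) u (frame n G u (coord (b j))) := fun j => by
    simpa only [one_mul] using lieDeriv_mul_loc (b j) hF 1 hu
  have h2 : e = frame n G u (Ring.inverse (frame n G u) e) := by
    rw [← mul_apply_eq_comp, Ring.mul_inverse_cancel _ hu',
      one_apply_eq_self]
  have h3 := (b.map coord).sum_repr (Ring.inverse (frame n G u) e)
  conv_lhs => rw [h2, ← h3, map_sum, map_sum]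
  refine Finset.sum_congr rfl fun j _ => ?_
  rw [h1, map_smul, map_smul, frameCoeff, Complex.real_smul]
  rfl

/-- By the Leibniz rule a derivative of a localised function is a sum of localised functions, with
new cutoffs on the same `K`. This closure property is what allows iteration. -/
theorem lineDeriv_localize (hK : IsCompact K) (hKdom : K ⊆ dom n G)
    (hKunit : ∀ u ∈ K, IsUnit (frame n G u)) (c : Cut K) {F : G → ℂ} (hF : IsSmooth n F)
    (e : EuclideanSpace ℝ (Fin n)) :
    ∂_{e} (localize hK hKdom c F hF) = localize hK hKdom (c.deriv e) F hF +
      ∑ j, localize hK hKdom (c.mul (frameCoeff b e j) fun u hu =>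
        contDiffAt_frameCoeff b e j (hKdom hu) (hKunit u hu)) (lieDeriv (b j) F)
          (hF.lieDeriv (b j)) := by
  ext u
  rw [SchwartzMap.lineDerivOp_apply_eq_fderiv, add_apply, sum_apply]
  by_cases hu : u ∈ K
  · have h1 : DifferentiableAt ℝ c.toFun u := c.contDiff'.contDiffAt.differentiableAt (by simp)
    have h2 : DifferentiableAt ℝ (fun u => F (loc n G u)) u :=
      (hF.contDiffAt_comp_loc (hKdom hu)).differentiableAt (by simp)
    have h3 : fderiv ℝ (localize hK hKdom c F hF) u e =
        c.toFun u * fderiv ℝ (fun u => F (loc n G u)) u e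
          + F (loc n G u) * fderiv ℝ c.toFun u e := by
      have := fderiv_mul h1 h2
      exact congrArg (fun T : EuclideanSpace ℝ (Fin n) →L[ℝ] ℂ => T e) this
    rw [h3, fderiv_comp_loc b hF e (hKdom hu) (hKunit u hu), add_comm, Finset.mul_sum]
    refine congrArg₂ _ (mul_comm _ _) (Finset.sum_congr rfl fun j _ => ?_)
    exact (mul_assoc _ _ _).symm
  · simp only [localize, Cut.toSchwartz_apply, Cut.eq_zero _ hu, Finset.sum_const_zero, add_zero]
    have := Cut.fderiv_eq_zero (c.mul (fun u => F (loc n G u))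
      fun _ hu => hF.contDiffAt_comp_loc (hKdom hu)) hu
    exact congrArg (fun T : EuclideanSpace ℝ (Fin n) →L[ℝ] ℂ => T e) this

/-- The induction quantifies over all cutoffs because each differentiation replaces the cutoff. The
innermost derivative is peeled off first, which puts `b j` to the right of the ordered monomials,
where the reordering estimate absorbs it. -/
theorem exists_norm_iterate_lineDeriv_localize_le (hK : IsCompact K) (hKdom : K ⊆ dom n G)
    (hKunit : ∀ u ∈ K, IsUnit (frame n G u)) (e : EuclideanSpace ℝ (Fin n)) (m : ℕ) :
    ∀ c : Cut K, ∃ C : ℝ, 0 ≤ C ∧ ∀ (F : G → ℂ) (hF : IsSmooth n F) (u),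
      ‖((fun v : 𝓢(EuclideanSpace ℝ (Fin n), ℂ) => ∂_{e} v)^[m] (localize hK hKdom c F hF)) u‖ ≤
        C * ∑ α ∈ multiIdx n m, ‖multiLieDeriv b α F (loc n G u)‖ := by
  induction m with
  | zero =>
    intro c
    obtain ⟨C, hC⟩ := hK.exists_bound_of_continuousOn c.contDiff'.continuous.continuousOn
    refine ⟨|C|, abs_nonneg C, fun F hF u => ?_⟩
    have h0 : (0 : Fin n → ℕ) ∈ multiIdx n 0 := by rw [mem_multiIdx]; simp
    have h1 : ‖F (loc n G u)‖ ≤ ∑ α ∈ multiIdx n 0, ‖multiLieDeriv b α F (loc n G u)‖ := by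
      refine le_trans (le_of_eq ?_) (Finset.single_le_sum
        (f := fun α => ‖multiLieDeriv b α F (loc n G u)‖) (fun _ _ => norm_nonneg _) h0)
      rw [multiLieDeriv_zero]
    refine le_trans ?_ (mul_le_mul_of_nonneg_left h1 (abs_nonneg C))
    have h2 : localize hK hKdom c F hF u = c.toFun u * F (loc n G u) := rfl
    rw [Function.iterate_zero_apply, h2, norm_mul]
    refine mul_le_mul_of_nonneg_right ?_ (norm_nonneg _)
    by_cases hu : u ∈ K
    · exact (hC u hu).trans (le_abs_self C)
    · rw [c.eq_zero hu, norm_zero]; exact abs_nonneg C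
  | succ m ih =>
    intro c
    obtain ⟨C₀, hC₀, h₀⟩ := ih (c.deriv e)
    choose C hC h using fun j => ih (c.mul (frameCoeff b e j) fun u hu =>
        contDiffAt_frameCoeff b e j (hKdom hu) (hKunit u hu))
    choose D hD h' using fun j => exists_sum_norm_multiLieDeriv_lieDeriv_le b j m
    refine ⟨C₀ + ∑ j, C j * D j, ?_, fun F hF u => ?_⟩
    · exact add_nonneg hC₀ (Finset.sum_nonneg fun j _ => mul_nonneg (hC j) (hD j))
    rw [Function.iterate_succ_apply, lineDeriv_localize b hK hKdom hKunit c hF e,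
      iterate_lineDeriv_add_sum, add_apply, sum_apply, add_mul,
      Finset.sum_mul]
    refine (norm_add_le _ _).trans (add_le_add ?_ ((norm_sum_le _ _).trans
      (Finset.sum_le_sum fun j _ => ?_)))
    · refine (h₀ F hF u).trans (mul_le_mul_of_nonneg_left ?_ hC₀)
      refine Finset.sum_le_sum_of_subset_of_nonneg (fun α hα => ?_) fun _ _ _ => norm_nonneg _
      rw [mem_multiIdx] at hα ⊢
      omega
    · refine (h j _ (hF.lieDeriv (b j)) u).trans ?_
      rw [mul_assoc]
      exact mul_le_mul_of_nonneg_left (h' j F hF _) (hC j)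

theorem IsSmooth.multiLieDeriv {f : G → ℂ} (hf : IsSmooth n f) (α : Fin n → ℕ) :
    IsSmooth n (multiLieDeriv b α f) := hf.iterLieDeriv _

theorem continuousOn_loc : ContinuousOn (loc n G) (dom n G) := fun _ hu =>
  (contMDiffAt_loc hu).continuousAt.continuousWithinAt

theorem integrableOn_norm_sq_comp_loc (hK : IsCompact K) (hKdom : K ⊆ dom n G) {f : G → ℂ}
    (hf : Continuous f) : IntegrableOn (fun u => ‖f (loc n G u)‖ ^ 2) K :=
  ((hf.comp_continuousOn (continuousOn_loc.mono hKdom)).norm.pow 2).integrableOn_compact hK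

theorem exists_integral_iterate_lineDeriv_localize_le (hK : IsCompact K) (hKdom : K ⊆ dom n G)
    (hKunit : ∀ u ∈ K, IsUnit (frame n G u)) (e : EuclideanSpace ℝ (Fin n)) {m k : ℕ}
    (hmk : m ≤ k) (c : Cut K) :
    ∃ C : ℝ, 0 ≤ C ∧ ∀ (F : G → ℂ) (hF : IsSmooth n F),
      ∫ u, ‖((fun v : 𝓢(EuclideanSpace ℝ (Fin n), ℂ) => ∂_{e} v)^[m]
        (localize hK hKdom c F hF)) u‖ ^ 2 ≤
        C * ∑ α ∈ multiIdx n k, ∫ u in K, ‖multiLieDeriv b α F (loc n G u)‖ ^ 2 := by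
  obtain ⟨C, hC, h⟩ := exists_norm_iterate_lineDeriv_localize_le b hK hKdom hKunit e m c
  -- The cardinality comes from bounding the square of a sum by the number of terms times the sum of
  -- squares.
  refine ⟨C ^ 2 * (multiIdx n k).card, by positivity, fun F hF => ?_⟩
  set v := (fun v : 𝓢(EuclideanSpace ℝ (Fin n), ℂ) => ∂_{e} v)^[m] (localize hK hKdom c F hF)
  have hv : ∀ u ∉ K, ‖v u‖ ^ 2 = 0 := fun u hu => by
    have : v u = 0 := image_eq_zero_of_notMem_tsupport fun h => hu
      ((Cut.tsupport_subset_compact (c.mul (fun u => F (loc n G u))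
        fun _ hu => hF.contDiffAt_comp_loc (hKdom hu))) (tsupport_iterate_lineDeriv_subset e m _ h))
    rw [this]; simp
  have h_int : ∀ α ∈ multiIdx n k, IntegrableOn
      (fun u => ‖multiLieDeriv b α F (loc n G u)‖ ^ 2) K := fun α _ =>
    integrableOn_norm_sq_comp_loc hK hKdom (hF.multiLieDeriv b α).continuous
  rw [← setIntegral_eq_integral_of_forall_compl_eq_zero hv, ← integral_finsetSum _ h_int,
    ← integral_const_mul]
  refine integral_mono (integrable_norm_sq_schwartz v).integrableOn
    ((integrable_finsetSum _ h_int).const_mul _) fun u => ?_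
  have h1 : ‖v u‖ ≤ C * ∑ α ∈ multiIdx n k, ‖multiLieDeriv b α F (loc n G u)‖ := by
    refine (h F hF u).trans (mul_le_mul_of_nonneg_left ?_ hC)
    refine Finset.sum_le_sum_of_subset_of_nonneg (fun α hα => ?_) fun _ _ _ => norm_nonneg _
    rw [mem_multiIdx] at hα ⊢
    omega
  refine (pow_le_pow_left₀ (norm_nonneg _) h1 2).trans ?_
  rw [mul_pow, mul_assoc]
  exact mul_le_mul_of_nonneg_left sq_sum_le_card_mul_sum_sq (sq_nonneg C)

/-- The local Sobolev inequality near the identity. -/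
theorem exists_local_sobolev {k : ℕ} (hk : (n : ℝ) / 2 < k) :
    ∃ K : Set (EuclideanSpace ℝ (Fin n)), IsCompact K ∧ K ⊆ dom n G ∧
      ∃ V ∈ 𝓝 (1 : G), ∃ C : ℝ, 0 ≤ C ∧ ∀ F : G → ℂ, IsSmooth n F → ∀ y ∈ V,
        ‖F y‖ ^ 2 ≤ C * ∑ α ∈ multiIdx n k, ∫ u in K, ‖multiLieDeriv b α F (loc n G u)‖ ^ 2 := by
  -- The frame is the identity at the origin and units form an open set, so it stays invertible
  -- nearby.
  have hev : ∀ᶠ u in 𝓝 (origin n G), u ∈ dom n G ∧ IsUnit (frame n G u) := by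
    refine Filter.Eventually.and (dom_mem_nhds (n := n) (G := G)) ?_
    refine (contDiffAt_frame (n := n) (G := G) origin_mem_dom).continuousAt.eventually_mem
      (s := {T | IsUnit T}) ?_
    refine Units.isOpen.mem_nhds ?_
    rw [mem_ofPred_eq, frame_origin]
    exact isUnit_one
  obtain ⟨r, hr, hrK⟩ := Metric.nhds_basis_closedBall.mem_iff.1 hev
  have hK : IsCompact (Metric.closedBall (origin n G) r) := isCompact_closedBall _ _
  have hKdom : Metric.closedBall (origin n G) r ⊆ dom n G := fun u hu => (hrK hu).1
  have hKunit : ∀ u ∈ Metric.closedBall (origin n G) r, IsUnit (frame n G u) :=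
    fun u hu => (hrK hu).2
  let β : ContDiffBump (origin n G) := ⟨r / 2, r, by linarith, by linarith⟩
  let χ : Cut (Metric.closedBall (origin n G) r) :=
    { toFun := fun u => (β u : ℂ)
      contDiff' := Complex.ofRealCLM.contDiff.comp β.contDiff
      tsupport_subset_compact := by
        refine (tsupport_comp_subset (g := Complex.ofReal) (by simp) β).trans ?_
        rw [β.tsupport_eq] }
  obtain ⟨C, hC, hsob⟩ := exists_sobolev_schwartz hk
  obtain ⟨C₀, hC₀, h₀⟩ := exists_integral_iterate_lineDeriv_localize_le b hK hKdom hKunit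
    0 (Nat.zero_le k) χ
  choose D hD h using fun i : Fin n => exists_integral_iterate_lineDeriv_localize_le b hK hKdom
    hKunit (EuclideanSpace.single i (1 : ℝ)) (le_refl k) χ
  -- On the half-radius ball the bump equals `1`, so the localised function takes the value `F y`
  -- there.
  refine ⟨_, hK, hKdom, {y | y ∈ (extChartAt (𝓡 n) (1 : G)).source ∧
    extChartAt (𝓡 n) (1 : G) y ∈ Metric.closedBall (origin n G) (r / 2)}, ?_,
    C * (C₀ + ∑ i, D i), ?_, fun F hF y hy => ?_⟩
  · exact inter_mem (extChartAt_source_mem_nhds (1 : G))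
      ((continuousAt_extChartAt (I := 𝓡 n) (1 : G)) (Metric.closedBall_mem_nhds _ (by linarith)))
  · exact mul_nonneg hC (add_nonneg hC₀ (Finset.sum_nonneg fun i _ => hD i))
  · have h1 := hsob (localize hK hKdom χ F hF) (extChartAt (𝓡 n) (1 : G) y)
    have h2 : localize hK hKdom χ F hF (extChartAt (𝓡 n) (1 : G) y) = F y := by
      have : localize hK hKdom χ F hF (extChartAt (𝓡 n) (1 : G) y) =
        (β (extChartAt (𝓡 n) (1 : G) y) : ℂ) * F (loc n G (extChartAt (𝓡 n) (1 : G) y)) := rfl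
      rw [this, loc, (extChartAt (𝓡 n) (1 : G)).left_inv hy.1, β.one_of_mem_closedBall hy.2]
      simp
    rw [h2] at h1
    refine h1.trans ?_
    rw [mul_assoc, add_mul, Finset.sum_mul]
    refine mul_le_mul_of_nonneg_left (add_le_add (h₀ F hF)
      (Finset.sum_le_sum fun i _ => h i F hF)) hC

end LocalSobolev

/-! ### Unimodularity of compact groups. -/

section HaarMeasure

variable {G : Type*} [Group G] [TopologicalSpace G] [IsTopologicalGroup G] [CompactSpace G]
  [MeasurableSpace G] [BorelSpace G]

/-- A right translate of `μ` is again a left Haar probability measure, hence equal to `μ` by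
uniqueness. -/
theorem isMulRightInvariant_of_compactSpace (μ : Measure G) [μ.IsHaarMeasure]
    [IsProbabilityMeasure μ] : μ.IsMulRightInvariant := by
  refine ⟨fun g => ?_⟩
  have : IsProbabilityMeasure (μ.map (· * g)) :=
    Measure.isProbabilityMeasure_map (measurable_mul_const g).aemeasurable
  exact Measure.isHaarMeasure_eq_of_isProbabilityMeasure _ _

end HaarMeasure

/-! ### The global Sobolev inequality. -/

section Sobolev

variable {n : ℕ} {G : Type*} [Group G] [TopologicalSpace G]
  [ChartedSpace (EuclideanSpace ℝ (Fin n)) G] [LieGroup (𝓡 n) ∞ G]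
  [IsTopologicalGroup G] [CompactSpace G] [T2Space G] [SecondCountableTopology G]
  [MeasurableSpace G] [BorelSpace G] (μ : Measure G) [μ.IsHaarMeasure] [IsProbabilityMeasure μ]
  [μ.IsMulRightInvariant]
  (b : Module.Basis (Fin n) ℝ (GroupLieAlgebra (𝓡 n) G))

theorem _root_.Continuous.integrable_of_compactSpace {X F : Type*} [TopologicalSpace X]
    [CompactSpace X] [T2Space X] [MeasurableSpace X] [BorelSpace X] [SecondCountableTopology X]
    [NormedAddCommGroup F] {ν : Measure X} [IsFiniteMeasure ν] {f : X → F} (hf : Continuous f) :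
    Integrable f ν := by
  rw [← integrableOn_univ]
  exact hf.continuousOn.integrableOn_compact isCompact_univ

theorem integrable_norm_sq_mul_loc {K : Set (EuclideanSpace ℝ (Fin n))} (hK : IsCompact K)
    (hKdom : K ⊆ dom n G) {h : G → ℂ} (hh : Continuous h) (x : G) :
    Integrable (Function.uncurry fun (g : G) u => ‖h (x * g * loc n G u)‖ ^ 2)
      (μ.prod (volume.restrict K)) := by
  have h1 : μ.prod (volume.restrict K) = (μ.prod volume).restrict (univ ×ˢ K) := by
    rw [← Measure.prod_restrict, Measure.restrict_univ]
  rw [h1]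
  refine ContinuousOn.integrableOn_compact (isCompact_univ.prod hK) ?_
  refine ((hh.comp_continuousOn ?_).norm).pow 2
  refine ContinuousOn.mul (by fun_prop) ?_
  exact (continuousOn_loc.mono hKdom).comp continuousOn_snd fun p hp => hp.2

/-- The Sobolev inequality on a compact Lie group. -/
theorem exists_sobolev {k : ℕ} (hk : (n : ℝ) / 2 < k) :
    ∃ C : ℝ, 0 ≤ C ∧ ∀ f : G → ℂ, IsSmooth n f → ∀ x,
      ‖f x‖ ^ 2 ≤ C * ∑ α ∈ multiIdx n k, ∫ y, ‖multiLieDeriv b α f y‖ ^ 2 ∂μ := by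
  obtain ⟨K, hK, hKdom, V, hV, C, hC, hloc⟩ := exists_local_sobolev b hk
  obtain ⟨V', hV'V, hV'o, hV'1⟩ := mem_nhds_iff.1 hV
  have hpos : 0 < μ.real (V'⁻¹) := by
    rw [measureReal_def]
    refine ENNReal.toReal_pos (IsOpen.measure_ne_zero μ hV'o.inv ⟨1, by simpa using hV'1⟩)
      (measure_ne_top _ _)
  refine ⟨(μ.real V'⁻¹)⁻¹ * (C * volume.real K), by positivity, fun f hf x => ?_⟩
  rw [mul_assoc, ← div_eq_inv_mul, le_div_iff₀ hpos, mul_comm]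
  -- The local inequality for `z ↦ f (x * g * z)` at the point `g⁻¹` always controls the same value
  -- `f x`, while left-invariant derivatives commute with the translation. Varying `g` over a set of
  -- positive measure allows averaging.
  have hpt : ∀ g ∈ V'⁻¹, ‖f x‖ ^ 2 ≤ C * ∑ α ∈ multiIdx n k,
      ∫ u in K, ‖multiLieDeriv b α f (x * g * loc n G u)‖ ^ 2 := by
    intro g hg
    have := hloc (fun z => f (x * g * z)) (hf.mul_left (x * g)) g⁻¹ (hV'V hg)
    simp only [mul_inv_cancel_right] at this
    convert this using 6 with α _ u
    exact congrArg norm (congrFun (iterLieDeriv_mul_left _ hf (x * g)) (loc n G u)).symm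
  have hprod := fun α : Fin n → ℕ => integrable_norm_sq_mul_loc μ hK hKdom
    (hf.multiLieDeriv b α).continuous x
  have hi : ∀ α : Fin n → ℕ, Integrable
      (fun g => ∫ u in K, ‖multiLieDeriv b α f (x * g * loc n G u)‖ ^ 2) μ :=
    fun α => (hprod α).integral_prod_left
  have h_int : Integrable (fun g => C * ∑ α ∈ multiIdx n k,
      ∫ u in K, ‖multiLieDeriv b α f (x * g * loc n G u)‖ ^ 2) μ :=
    (integrable_finsetSum _ fun α _ => hi α).const_mul C
  calc μ.real V'⁻¹ * ‖f x‖ ^ 2 = ∫ g in V'⁻¹, ‖f x‖ ^ 2 ∂μ := by simp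
    _ ≤ ∫ g in V'⁻¹, C * ∑ α ∈ multiIdx n k,
        (∫ u in K, ‖multiLieDeriv b α f (x * g * loc n G u)‖ ^ 2) ∂μ :=
      setIntegral_mono_on (by simp) h_int.integrableOn hV'o.inv.measurableSet hpt
    _ ≤ ∫ g, C * ∑ α ∈ multiIdx n k,
        (∫ u in K, ‖multiLieDeriv b α f (x * g * loc n G u)‖ ^ 2) ∂μ :=
      setIntegral_le_integral h_int (Eventually.of_forall fun g => mul_nonneg hC
        (Finset.sum_nonneg fun α _ => integral_nonneg fun u => sq_nonneg _))
    _ = C * ∑ α ∈ multiIdx n k, volume.real K * ∫ y, ‖multiLieDeriv b α f y‖ ^ 2 ∂μ := by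
      rw [integral_const_mul, integral_finsetSum _ fun α _ => hi α]
      congr 1
      refine Finset.sum_congr rfl fun α _ => ?_
      refine (integral_integral_swap (hprod α)).trans ?_
      -- Two-sided invariance of `μ` removes both `x` and `loc n G u`, so the integral over `K`
      -- contributes only its volume.
      have : ∀ u, ∫ g, ‖multiLieDeriv b α f (x * g * loc n G u)‖ ^ 2 ∂μ =
          ∫ y, ‖multiLieDeriv b α f y‖ ^ 2 ∂μ := fun u => by
        rw [integral_mul_left_eq_self (fun g => ‖multiLieDeriv b α f (g * loc n G u)‖ ^ 2) x,
          integral_mul_right_eq_self (fun g => ‖multiLieDeriv b α f g‖ ^ 2)]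
      simp only [this, integral_const, smul_eq_mul, measureReal_restrict_apply_univ]
    _ = C * volume.real K * ∑ α ∈ multiIdx n k, ∫ y, ‖multiLieDeriv b α f y‖ ^ 2 ∂μ := by
      rw [← Finset.mul_sum, mul_assoc]

end Sobolev

/-! ### The topology of smooth functions and right-finite functions. -/

section SmoothFunctionSpace

variable {n : ℕ} {G : Type*} [Group G] [TopologicalSpace G]
  [ChartedSpace (EuclideanSpace ℝ (Fin n)) G]

theorem tendsto_smoothFun_iff {ι : Type*} {l : Filter ι} {F : ι → SmoothFun n G}
    {f : SmoothFun n G} :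
    Tendsto F l (𝓝 f) ↔ ∀ L : List (GroupLieAlgebra (𝓡 n) G),
      TendstoUniformly (fun i => iterLieDeriv L (F i)) (iterLieDeriv L f) l := by
  rw [nhds_induced, tendsto_comap_iff, tendsto_pi_nhds]
  refine forall_congr' fun L => ?_
  rw [UniformFun.tendsto_iff_tendstoUniformly]
  rfl

variable [LieGroup (𝓡 n) ∞ G]

/-- Right translation of smooth functions. -/
def rightTranslate (g : G) : SmoothFun n G →ₗ[ℂ] SmoothFun n G where
  toFun f := ⟨fun x => f (x * g), (SmoothFun.isSmooth f).mul_right g⟩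
  map_add' _ _ := rfl
  map_smul' _ _ := rfl

theorem rightTranslate_apply (g : G) (f : SmoothFun n G) (x : G) :
    rightTranslate g f x = f (x * g) := rfl

/-- Subspaces of `C^∞(G)` that are stable under right translations. -/
def IsRightInvariant (V : Submodule ℂ (SmoothFun n G)) : Prop :=
  ∀ g : G, ∀ f ∈ V, rightTranslate g f ∈ V

theorem IsRightInvariant.sup {V W : Submodule ℂ (SmoothFun n G)} (hV : IsRightInvariant V)
    (hW : IsRightInvariant W) : IsRightInvariant (V ⊔ W) := by
  intro g f hf
  obtain ⟨v, hv, w, hw, rfl⟩ := Submodule.mem_sup.1 hf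
  rw [map_add]
  exact Submodule.mem_sup.2 ⟨_, hV g v hv, _, hW g w hw, rfl⟩

variable (n G) in
/-- The smooth functions whose right translates span a finite-dimensional space. -/
def finiteFun : Submodule ℂ (SmoothFun n G) where
  carrier := {f | ∃ V : Submodule ℂ (SmoothFun n G), FiniteDimensional ℂ V ∧
    IsRightInvariant V ∧ f ∈ V}
  zero_mem' := ⟨⊥, inferInstance, fun g f hf => by
    rw [Submodule.mem_bot] at hf ⊢; rw [hf, map_zero], Submodule.zero_mem _⟩
  add_mem' := by
    rintro f g ⟨V, hV, hVi, hf⟩ ⟨W, hW, hWi, hg⟩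
    exact ⟨V ⊔ W, inferInstance, hVi.sup hWi,
      Submodule.add_mem_sup hf hg⟩
  smul_mem' := by
    rintro c f ⟨V, hV, hVi, hf⟩
    exact ⟨V, hV, hVi, V.smul_mem c hf⟩

end SmoothFunctionSpace

/-! ### Smooth functions inside `L²`. -/

section L2

variable {n : ℕ} {G : Type*} [Group G] [TopologicalSpace G]
  [ChartedSpace (EuclideanSpace ℝ (Fin n)) G] [LieGroup (𝓡 n) ∞ G]
  [CompactSpace G] [T2Space G] [SecondCountableTopology G]
  [MeasurableSpace G] [BorelSpace G] (μ : Measure G) [IsProbabilityMeasure μ]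

variable (n) in
/-- The embedding of `C^∞(G)` into `L²(G)` as a linear map. -/
def toL2Hom : SmoothFun n G →ₗ[ℂ] Lp ℂ 2 μ where
  toFun := toL2 μ
  map_add' f g := (ContinuousMap.toLp 2 μ ℂ).map_add ⟨f, f.contMDiff.continuous⟩
    ⟨g, g.contMDiff.continuous⟩
  map_smul' c f := (ContinuousMap.toLp 2 μ ℂ).map_smul c ⟨f, f.contMDiff.continuous⟩

theorem toL2Hom_apply (f : SmoothFun n G) : toL2Hom n μ f = toL2 μ f := rfl

theorem coeFn_toL2 (f : SmoothFun n G) : toL2 μ f =ᵐ[μ] f :=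
  ContinuousMap.coeFn_toLp (p := 2) (𝕜 := ℂ) μ _

theorem inner_toL2 (f g : SmoothFun n G) :
    inner ℂ (toL2 μ f) (toL2 μ g) = ∫ x, conj (f x) * g x ∂μ := by
  rw [L2.inner_def]
  refine integral_congr_ae ?_
  filter_upwards [coeFn_toL2 μ f, coeFn_toL2 μ g] with x hf hg
  rw [hf, hg, RCLike.inner_apply, mul_comm]

theorem norm_toL2_sq (f : SmoothFun n G) : ‖toL2 μ f‖ ^ 2 = ∫ x, ‖f x‖ ^ 2 ∂μ := by
  have h := inner_self_eq_norm_sq_to_K (𝕜 := ℂ) (toL2 μ f)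
  rw [inner_toL2] at h
  have h2 : (fun x => conj (f x) * f x) = fun x => ((‖f x‖ ^ 2 : ℝ) : ℂ) := by
    ext x
    rw [mul_comm, RCLike.mul_conj]
    simp
  rw [h2, integral_complex_ofReal] at h
  exact Complex.ofReal_injective (by simpa using h.symm)

theorem toL2_injective [μ.IsOpenPosMeasure] : Function.Injective (toL2Hom n μ) := by
  intro f g h
  have := ContinuousMap.toLp_injective (p := 2) (𝕜 := ℂ) μ h
  ext x
  exact congrArg (fun F : C(G, ℂ) => F x) this

theorem continuous_toL2 : Continuous (toL2 μ : SmoothFun n G → Lp ℂ 2 μ) := by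
  have h : Continuous (fun f : SmoothFun n G => (⟨f, f.contMDiff.continuous⟩ : C(G, ℂ))) := by
    rw [continuous_iff_continuousAt]
    intro f
    have := tendsto_smoothFun_iff.1 (tendsto_id (x := 𝓝 f)) []
    rw [ContinuousAt, ContinuousMap.tendsto_iff_tendstoUniformly]
    exact this
  exact (ContinuousMap.toLp 2 μ ℂ).continuous.comp h

theorem integrable_of_Lp2 (h : Lp ℂ 2 μ) : Integrable h μ :=
  (Lp.memLp h).integrable (by norm_num)

theorem integral_norm_le_norm (h : Lp ℂ 2 μ) : ∫ x, ‖h x‖ ∂μ ≤ ‖h‖ := by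
  have h1 : ∫ x, ‖h x‖ ∂μ = (eLpNorm h 1 μ).toReal := by
    rw [eLpNorm_one_eq_lintegral_enorm,
      integral_norm_eq_lintegral_enorm (Lp.aestronglyMeasurable h)]
  rw [h1, Lp.norm_def]
  refine ENNReal.toReal_mono (Lp.eLpNorm_ne_top h) ?_
  exact eLpNorm_le_eLpNorm_of_exponent_le (by norm_num) (Lp.aestronglyMeasurable h)

end L2

theorem integrable_mul_continuous {X : Type*} [TopologicalSpace X] [CompactSpace X]
    [SecondCountableTopology X] [MeasurableSpace X] [BorelSpace X] (μ : Measure X)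
    {h k : X → ℂ} (hh : Integrable h μ) (hk : Continuous k) :
    Integrable (fun z => h z * k z) μ := by
  obtain ⟨C, hC⟩ := isCompact_univ.exists_bound_of_continuousOn hk.continuousOn
  refine (hh.norm.mul_const C).mono' (hh.aestronglyMeasurable.mul hk.aestronglyMeasurable)
    (Eventually.of_forall fun z => ?_)
  rw [norm_mul]
  exact mul_le_mul_of_nonneg_left (hC z (mem_univ _)) (norm_nonneg _)

/-! ### Convolution operators: smoothing, compactness and spectral decomposition. -/

section Convolution

variable {n : ℕ} {G : Type*} [Group G] [TopologicalSpace G]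
  [ChartedSpace (EuclideanSpace ℝ (Fin n)) G] [LieGroup (𝓡 n) ∞ G]
  [IsTopologicalGroup G] [CompactSpace G] [T2Space G] [SecondCountableTopology G]
  [MeasurableSpace G] [BorelSpace G] (μ : Measure G) [IsProbabilityMeasure μ]
  (p : SmoothFun n G)

theorem contMDiff_convKernel : ContMDiff ((𝓡 n).prod (𝓡 n)) 𝓘(ℝ, ℂ) ∞
    (Function.uncurry fun x z : G => p (x * z⁻¹)) :=
  p.contMDiff.comp (contMDiff_fst.mul (contMDiff_snd.inv))

theorem contMDiff_leftKernel : ContMDiff ((𝓡 n).prod (𝓡 n)) 𝓘(ℝ, ℂ) ∞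
    (Function.uncurry fun x z : G => p (z * x)) :=
  p.contMDiff.comp (contMDiff_snd.mul contMDiff_fst)

/-- Convolution with the smooth function `p`: `h ↦ ∫ h(z) p(x z⁻¹) dz`. -/
def conv : Lp ℂ 2 μ →ₗ[ℂ] SmoothFun n G where
  toFun h := ⟨fun x => ∫ z, h z * p (x * z⁻¹) ∂μ,
    isSmooth_integral_param (integrable_of_Lp2 μ h) (contMDiff_convKernel p)⟩
  map_add' h k := by
    ext x
    have hc : Continuous fun z => p (x * z⁻¹) := p.contMDiff.continuous.comp (by fun_prop)
    show ∫ z, (h + k : Lp ℂ 2 μ) z * p (x * z⁻¹) ∂μ =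
      (∫ z, h z * p (x * z⁻¹) ∂μ) + ∫ z, k z * p (x * z⁻¹) ∂μ
    rw [← integral_add (integrable_mul_continuous μ (integrable_of_Lp2 μ h) hc)
      (integrable_mul_continuous μ (integrable_of_Lp2 μ k) hc)]
    refine integral_congr_ae ?_
    filter_upwards [Lp.coeFn_add h k] with z hz
    rw [hz, Pi.add_apply, add_mul]
  map_smul' c h := by
    ext x
    show ∫ z, (c • h : Lp ℂ 2 μ) z * p (x * z⁻¹) ∂μ = c * ∫ z, h z * p (x * z⁻¹) ∂μ
    rw [← integral_const_mul]
    refine integral_congr_ae ?_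
    filter_upwards [Lp.coeFn_smul c h] with z hz
    rw [hz, Pi.smul_apply, smul_eq_mul, mul_assoc]

theorem conv_apply (h : Lp ℂ 2 μ) (x : G) : conv μ p h x = ∫ z, h z * p (x * z⁻¹) ∂μ := rfl

theorem conv_toL2_apply (f : SmoothFun n G) (x : G) :
    conv μ p (toL2 μ f) x = ∫ z, f z * p (x * z⁻¹) ∂μ := by
  rw [conv_apply]
  refine integral_congr_ae ?_
  filter_upwards [coeFn_toL2 μ f] with z hz
  rw [hz]

/-- All derivatives fall on the kernel, which is bounded on the compact `G × G`, and on a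
probability space the `L¹` norm is at most the `L²` norm. This yields continuity from `L²` into
smooth functions. -/
theorem exists_norm_iterLieDeriv_conv_le (L : List (GroupLieAlgebra (𝓡 n) G)) :
    ∃ C : ℝ, ∀ (h : Lp ℂ 2 μ) (x : G), ‖iterLieDeriv L (conv μ p h) x‖ ≤ C * ‖h‖ := by
  have hcont := (contMDiff_iterLieDeriv_param (contMDiff_convKernel p) L).continuous
  obtain ⟨C, hC⟩ := isCompact_univ.exists_bound_of_continuousOn hcont.continuousOn
  have hC0 : 0 ≤ C := (norm_nonneg _).trans (hC (1, 1) (mem_univ _))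
  refine ⟨C, fun h x => ?_⟩
  have h1 := congrFun (iterLieDeriv_integral_param (integrable_of_Lp2 μ h)
    (contMDiff_convKernel p) L) x
  refine (congrArg norm h1).trans_le ?_
  calc _ ≤ ∫ z, ‖h z‖ * C ∂μ := by
        refine norm_integral_le_of_norm_le ((integrable_of_Lp2 μ h).norm.mul_const C)
          (Eventually.of_forall fun z => ?_)
        rw [norm_mul]
        exact mul_le_mul_of_nonneg_left (hC (x, z) (mem_univ _)) (norm_nonneg _)
    _ = C * ∫ z, ‖h z‖ ∂μ := by rw [integral_mul_const, mul_comm]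
    _ ≤ C * ‖h‖ := mul_le_mul_of_nonneg_left (integral_norm_le_norm μ h) hC0

theorem iterLieDeriv_sub_apply (L : List (GroupLieAlgebra (𝓡 n) G)) (f g : SmoothFun n G)
    (x : G) : iterLieDeriv L (f - g : SmoothFun n G) x =
      iterLieDeriv L f x - iterLieDeriv L g x := by
  have h := iterLieDeriv_add L (SmoothFun.isSmooth (f - g)) (SmoothFun.isSmooth g)
  have h2 : ⇑(f - g) + ⇑g = ⇑f := by ext y; simp
  rw [h2] at h
  rw [h, Pi.add_apply, add_sub_cancel_right]

theorem continuous_conv : Continuous (conv μ p) := by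
  rw [continuous_iff_continuousAt]
  intro h
  rw [ContinuousAt, tendsto_smoothFun_iff]
  intro L
  obtain ⟨C, hC⟩ := exists_norm_iterLieDeriv_conv_le μ p L
  rw [Metric.tendstoUniformly_iff]
  intro ε hε
  have h1 : Tendsto (fun k : Lp ℂ 2 μ => C * ‖h - k‖) (𝓝 h) (𝓝 0) := by
    have : Continuous (fun k : Lp ℂ 2 μ => C * ‖h - k‖) := by fun_prop
    simpa using this.tendsto h
  filter_upwards [h1.eventually_lt_const hε] with k hk x
  rw [dist_eq_norm, ← iterLieDeriv_sub_apply, ← map_sub]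
  exact (hC _ _).trans_lt hk

/-- Convolution with `p` as an operator on `L²(G)`. -/
def convL2 : Lp ℂ 2 μ →L[ℂ] Lp ℂ 2 μ where
  toLinearMap := toL2Hom n μ ∘ₗ conv μ p
  cont := (continuous_toL2 μ).comp (continuous_conv μ p)

theorem convL2_apply (h : Lp ℂ 2 μ) : convL2 μ p h = toL2 μ (conv μ p h) := rfl

/-- The values of `conv` as bounded continuous functions. -/
def convBounded : Lp ℂ 2 μ →ₗ[ℂ] BoundedContinuousFunction G ℂ where
  toFun h := BoundedContinuousFunction.mkOfCompact
    ⟨conv μ p h, (conv μ p h).contMDiff.continuous⟩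
  map_add' h k := by ext x; exact congrArg (fun f : SmoothFun n G => f x) (map_add (conv μ p) h k)
  map_smul' c h := by
    ext x; exact congrArg (fun f : SmoothFun n G => f x) (map_smul (conv μ p) c h)

/-- Arzelà–Ascoli: equicontinuity comes from continuity of `x ↦ p (x * ·⁻¹)` in the supremum norm,
uniformly over the unit ball of `L²`. -/
theorem isCompactOperator_convBounded : IsCompactOperator (convBounded μ p) := by
  rw [isCompactOperator_iff_isCompact_closure_image_closedBall (𝕜₁ := ℂ) (convBounded μ p)
    one_pos]
  obtain ⟨C, hC⟩ := exists_norm_iterLieDeriv_conv_le μ p []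
  have hC' : ∀ h ∈ Metric.closedBall (0 : Lp ℂ 2 μ) 1, ∀ x, ‖conv μ p h x‖ ≤ |C| := by
    intro h hh x
    refine (hC h x).trans ?_
    have h1 : ‖h‖ ≤ 1 := by simpa using hh
    calc C * ‖h‖ ≤ |C| * 1 := mul_le_mul (le_abs_self C) h1 (norm_nonneg _) (abs_nonneg _)
      _ = |C| := mul_one _
  refine BoundedContinuousFunction.arzela_ascoli (Metric.closedBall 0 |C|)
    (isCompact_closedBall _ _) _ ?_ ?_
  · rintro _ x ⟨h, hh, rfl⟩
    exact mem_closedBall_zero_iff.2 (hC' h hh x)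
  · intro x₀
    rw [Metric.equicontinuousAt_iff_right]
    intro ε hε
    let κ : C(G, C(G, ℂ)) := ContinuousMap.curry
      ⟨fun q : G × G => p (q.1 * q.2⁻¹), p.contMDiff.continuous.comp (by fun_prop)⟩
    have hκ : ∀ᶠ x in 𝓝 x₀, dist (κ x) (κ x₀) < ε :=
      (κ.continuous.tendsto x₀) (Metric.ball_mem_nhds _ hε)
    filter_upwards [hκ] with x hx
    rintro ⟨_, h, hh, rfl⟩
    show dist (conv μ p h x₀) (conv μ p h x) < ε
    rw [dist_comm]
    refine lt_of_le_of_lt ?_ hx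
    have h1 : ‖h‖ ≤ 1 := by simpa using hh
    have hi : ∀ x, Integrable (fun z => h z * p (x * z⁻¹)) μ := fun x =>
      integrable_mul_continuous μ (integrable_of_Lp2 μ h)
        (p.contMDiff.continuous.comp (by fun_prop))
    rw [dist_eq_norm, conv_apply, conv_apply, ← integral_sub (hi x) (hi x₀)]
    calc _ ≤ ∫ z, ‖h z‖ * dist (κ x) (κ x₀) ∂μ := by
          refine norm_integral_le_of_norm_le ((integrable_of_Lp2 μ h).norm.mul_const _)
            (Eventually.of_forall fun z => ?_)
          rw [← mul_sub, norm_mul, ← dist_eq_norm]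
          exact mul_le_mul_of_nonneg_left
            (ContinuousMap.dist_apply_le_dist (f := κ x) (g := κ x₀) z) (norm_nonneg _)
      _ = (∫ z, ‖h z‖ ∂μ) * dist (κ x) (κ x₀) := integral_mul_const _ _
      _ ≤ 1 * dist (κ x) (κ x₀) :=
        mul_le_mul_of_nonneg_right ((integral_norm_le_norm μ h).trans h1) dist_nonneg
      _ = _ := one_mul _

theorem isCompactOperator_convL2 : IsCompactOperator (convL2 μ p) :=
  (isCompactOperator_convBounded μ p).clm_comp (BoundedContinuousFunction.toLp 2 μ ℂ)

/-- The condition on `p` says that the kernel `p (x * z⁻¹)` is Hermitian; the rest is Fubini. -/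
theorem isSymmetric_convL2 (hp : ∀ w, p w⁻¹ = conj (p w)) :
    (convL2 μ p : Lp ℂ 2 μ →ₗ[ℂ] Lp ℂ 2 μ).IsSymmetric := by
  intro h k
  show inner ℂ (convL2 μ p h) k = inner ℂ h (convL2 μ p k)
  rw [L2.inner_def, L2.inner_def]
  have h1 : ∫ x, inner ℂ (convL2 μ p h x) (k x) ∂μ =
      ∫ x, ∫ z, conj (h z) * p (z * x⁻¹) * k x ∂μ ∂μ := by
    refine integral_congr_ae ?_
    filter_upwards [coeFn_toL2 μ (conv μ p h)] with x hx
    rw [convL2_apply, hx, RCLike.inner_apply, conv_apply, ← integral_conj, mul_comm,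
      ← integral_mul_const]
    refine integral_congr_ae (Eventually.of_forall fun z => ?_)
    simp only [map_mul, ← hp, mul_inv_rev, inv_inv]
  have h2 : ∫ z, inner ℂ (h z) (convL2 μ p k z) ∂μ =
      ∫ z, ∫ x, conj (h z) * p (z * x⁻¹) * k x ∂μ ∂μ := by
    refine integral_congr_ae ?_
    filter_upwards [coeFn_toL2 μ (conv μ p k)] with z hz
    rw [convL2_apply, hz, RCLike.inner_apply, conv_apply, mul_comm, ← integral_const_mul]
    refine integral_congr_ae (Eventually.of_forall fun x => ?_)
    simp only
    ring
  rw [h1, h2]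
  refine integral_integral_swap ?_
  have hprod : Integrable (fun q : G × G => k q.1 * conj (h q.2)) (μ.prod μ) :=
    (integrable_of_Lp2 μ k).mul_prod
      ((Complex.conjCLE.toContinuousLinearMap.integrable_comp (integrable_of_Lp2 μ h)))
  have hcont : Continuous fun q : G × G => p (q.2 * q.1⁻¹) :=
    p.contMDiff.continuous.comp (by fun_prop)
  refine (integrable_mul_continuous (μ.prod μ) hprod hcont).congr
    (Eventually.of_forall fun q => ?_)
  simp only [Function.uncurry]
  ring

/-- The eigenspaces of convolution operators consist of functions with finitely many independent
right translates. -/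
theorem conv_mem_finiteFun_of_mem_eigenspace [μ.IsMulRightInvariant] [μ.IsOpenPosMeasure] {c : ℂ}
    {h : Lp ℂ 2 μ}
    (hh : h ∈ Module.End.eigenspace (convL2 μ p : Module.End ℂ (Lp ℂ 2 μ)) c) :
    conv μ p h ∈ finiteFun n G := by
  rw [Module.End.mem_eigenspace_iff] at hh
  have hh' : toL2 μ (conv μ p h) = c • h := hh
  by_cases hc : c = 0
  · have : conv μ p h = 0 := by
      apply toL2_injective (n := n) μ
      rw [map_zero, toL2Hom_apply, hh', hc, zero_smul]
    rw [this]
    exact Submodule.zero_mem _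
  have hfd := ContinuousLinearMap.finite_dimensional_eigenspace (isCompactOperator_convL2 μ p) c hc
  refine ⟨(Module.End.eigenspace (convL2 μ p : Module.End ℂ (Lp ℂ 2 μ)) c).map (conv μ p),
    inferInstance, ?_, Submodule.mem_map_of_mem (Module.End.mem_eigenspace_iff.2 hh)⟩
  rintro g _ ⟨k, hk, rfl⟩
  have hk' : toL2 μ (conv μ p k) = c • k := Module.End.mem_eigenspace_iff.1 hk
  -- Convolution on this side commutes with right translations, by the substitution `z ↦ z * g`, so
  -- translates of eigenfunctions are eigenfunctions.
  have h1 : conv μ p (toL2 μ (rightTranslate g (conv μ p k))) =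
      c • rightTranslate g (conv μ p k) := by
    ext x
    rw [conv_toL2_apply]
    have h2 := integral_mul_right_eq_self (μ := μ)
      (fun z => conv μ p k z * p (x * g * z⁻¹)) g
    simp only [mul_inv_rev, mul_assoc, mul_inv_cancel_left] at h2
    have h3 := congrArg (fun f : SmoothFun n G => f (x * g)) (congrArg (conv μ p) hk')
    simp only [conv_toL2_apply, map_smul, mul_assoc] at h3
    simp only [rightTranslate_apply]
    exact h2.trans h3
  refine ⟨c⁻¹ • toL2 μ (rightTranslate g (conv μ p k)), ?_, ?_⟩
  · rw [SetLike.mem_coe, Module.End.mem_eigenspace_iff]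
    show convL2 μ p (c⁻¹ • toL2 μ (rightTranslate g (conv μ p k))) = _
    rw [map_smul, convL2_apply, h1, ← toL2Hom_apply, map_smul, smul_comm]
    rfl
  · rw [map_smul, h1, smul_smul, inv_mul_cancel₀ hc, one_smul]

/-- The eigenspaces span a dense subspace of `L²` by the spectral theorem. Since `conv` is
continuous into `C^∞(G)`, this `L²` density becomes approximation in the finer topology. -/
theorem conv_mem_closure_finiteFun [μ.IsMulRightInvariant] [μ.IsOpenPosMeasure]
    (hp : ∀ w, p w⁻¹ = conj (p w)) (h : Lp ℂ 2 μ) :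
    conv μ p h ∈ closure (finiteFun n G : Set (SmoothFun n G)) := by
  have h1 := ContinuousLinearMap.orthogonalComplement_iSup_eigenspaces_eq_bot
    (isCompactOperator_convL2 μ p) (isSymmetric_convL2 μ p hp)
  have h2 : (⨆ c, Module.End.eigenspace (convL2 μ p : Module.End ℂ (Lp ℂ 2 μ)) c) ≤
      (finiteFun n G).comap (conv μ p) :=
    iSup_le fun c k hk => conv_mem_finiteFun_of_mem_eigenspace μ p hk
  have h3 := Submodule.topologicalClosure_eq_top_iff.2 h1
  have h4 : h ∈ closure ((finiteFun n G).comap (conv μ p) : Set (Lp ℂ 2 μ)) := by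
    refine closure_mono h2 ?_
    rw [← Submodule.topologicalClosure_coe, h3]
    trivial
  exact map_mem_closure (continuous_conv μ p) h4 fun k hk => hk

end Convolution

/-! ### Approximate identities and density of right-finite functions. -/

section ApproximateIdentity

variable {n : ℕ} {G : Type*} [Group G] [TopologicalSpace G]
  [ChartedSpace (EuclideanSpace ℝ (Fin n)) G] [LieGroup (𝓡 n) ∞ G]
  [IsTopologicalGroup G] [CompactSpace G] [T2Space G] [SecondCountableTopology G]
  [MeasurableSpace G] [BorelSpace G] (μ : Measure G) [IsProbabilityMeasure μ]

/-- Symmetric smooth probability densities with support in a given neighbourhood of `1`. -/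
theorem exists_smooth_density [μ.IsOpenPosMeasure] {U : Set G} (hU : U ∈ 𝓝 (1 : G)) :
    ∃ (p : SmoothFun n G) (q : G → ℝ), (∀ w, p w = (q w : ℂ)) ∧ (∀ w, 0 ≤ q w) ∧
      (∀ w, q w⁻¹ = q w) ∧ (∀ w, w ∉ U → q w = 0) ∧ Continuous q ∧ ∫ w, q w ∂μ = 1 := by
  have hV : U ∩ U⁻¹ ∈ 𝓝 (1 : G) :=
    inter_mem hU (inv_mem_nhds_one G hU)
  obtain ⟨φ, -, hφ⟩ := (SmoothBumpFunction.nhds_basis_tsupport (I := 𝓡 n) (1 : G)).mem_iff.1 hV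
  have hφ0 : ∀ w, w ∉ U ∩ U⁻¹ → φ w = 0 := fun w hw =>
    image_eq_zero_of_notMem_tsupport fun h => hw (hφ h)
  -- Adding the inverted bump makes the density symmetric, and the intersection `U ∩ U⁻¹` keeps both
  -- summands supported in `U`.
  have hcont : Continuous fun w => φ w + φ w⁻¹ :=
    φ.continuous.add (φ.continuous.comp continuous_inv)
  have hnn : ∀ w, 0 ≤ φ w + φ w⁻¹ := fun w => add_nonneg φ.nonneg φ.nonneg
  have hpos : 0 < ∫ w, (φ w + φ w⁻¹) ∂μ := by
    refine hcont.integral_pos_of_hasCompactSupport_nonneg_nonzero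
      (HasCompactSupport.of_compactSpace _) hnn (x := 1) ?_
    rw [inv_one, φ.eq_one]
    norm_num
  set c := ∫ w, (φ w + φ w⁻¹) ∂μ with hc
  have hsm : ContMDiff (𝓡 n) 𝓘(ℝ, ℂ) ∞ fun w : G => ((c⁻¹ * (φ w + φ w⁻¹) : ℝ) : ℂ) := by
    have h1 : ContMDiff (𝓡 n) 𝓘(ℝ, ℝ) ∞ fun w : G => φ w + φ w⁻¹ :=
      φ.contMDiff.add (φ.contMDiff.comp (contMDiff_inv (𝓡 n) ∞))
    exact (Complex.ofRealCLM.comp (ContinuousLinearMap.mul ℝ ℝ c⁻¹)).contMDiff.comp h1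
  refine ⟨⟨_, hsm⟩, fun w => c⁻¹ * (φ w + φ w⁻¹), fun w => rfl,
    fun w => mul_nonneg (inv_nonneg.2 hpos.le) (hnn w), fun w => ?_, fun w hw => ?_,
    continuous_const.mul hcont, ?_⟩
  · simp only [inv_inv, add_comm]
  · simp only
    rw [hφ0 w fun h => hw h.1, hφ0 w⁻¹ fun h => hw (by simpa using h.2)]
    simp
  · rw [integral_const_mul, inv_mul_cancel₀ hpos.ne']

/-- The substitution `z ↦ z * x` and the symmetry of `q` turn the convolution into an average of
left translates of `f`, through which left-invariant derivatives pass. -/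
theorem iterLieDeriv_conv_toL2 [μ.IsMulRightInvariant] {p : SmoothFun n G} {q : G → ℝ}
    (hpq : ∀ w, p w = (q w : ℂ)) (hsymm : ∀ w, q w⁻¹ = q w) (f : SmoothFun n G)
    (L : List (GroupLieAlgebra (𝓡 n) G)) (x : G) :
    iterLieDeriv L (conv μ p (toL2 μ f)) x = ∫ z, p z * iterLieDeriv L f (z * x) ∂μ := by
  have h1 : ⇑(conv μ p (toL2 μ f)) = fun x => ∫ z, p z * f (z * x) ∂μ := by
    ext x
    rw [conv_toL2_apply, ← integral_mul_right_eq_self (μ := μ) _ x]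
    refine integral_congr_ae (Eventually.of_forall fun z => ?_)
    simp only [mul_inv_rev, mul_inv_cancel_left]
    rw [hpq, hpq, hsymm, mul_comm]
  have hp : Integrable p μ := p.contMDiff.continuous.integrable_of_compactSpace
  rw [h1, iterLieDeriv_integral_param hp (contMDiff_leftKernel f) L]
  refine integral_congr_ae (Eventually.of_forall fun z => ?_)
  simp only
  rw [iterLieDeriv_mul_left L (SmoothFun.isSmooth f) z]

theorem eventually_dist_mul_left_lt {h : G → ℂ} (hh : Continuous h) {ε : ℝ} (hε : 0 < ε) :
    ∀ᶠ z in 𝓝 (1 : G), ∀ x, dist (h (z * x)) (h x) < ε := by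
  let κ : C(G, C(G, ℂ)) := ContinuousMap.curry
    ⟨fun q : G × G => h (q.1 * q.2), hh.comp (by fun_prop)⟩
  have hκ : ∀ᶠ z in 𝓝 (1 : G), dist (κ z) (κ 1) < ε :=
    (κ.continuous.tendsto 1) (Metric.ball_mem_nhds _ hε)
  filter_upwards [hκ] with z hz x
  have h1 := (ContinuousMap.dist_apply_le_dist (f := κ z) (g := κ 1) x).trans_lt hz
  have h2 : κ 1 x = h x := congrArg h (one_mul x)
  rw [h2] at h1
  exact h1

/-- Averaging over shrinking neighbourhoods of `1` converges to `f` uniformly, and likewise for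
every iterated derivative; each average is a limit of right-finite functions. -/
theorem dense_finiteFun [μ.IsMulRightInvariant] [μ.IsOpenPosMeasure] :
    Dense (finiteFun n G : Set (SmoothFun n G)) := by
  intro f
  obtain ⟨u, hu⟩ := (𝓝 (1 : G)).exists_antitone_basis
  choose p q hpq hnn hsymm hsupp hcont h_int using
    fun m => exists_smooth_density (n := n) μ (hu.1.mem_of_mem (i := m) trivial)
  have hlim : Tendsto (fun m => conv μ (p m) (toL2 μ f)) atTop (𝓝 f) := by
    rw [tendsto_smoothFun_iff]
    intro L
    rw [Metric.tendstoUniformly_iff]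
    intro ε hε
    have hLc : Continuous (iterLieDeriv L f) := ((SmoothFun.isSmooth f).iterLieDeriv L).continuous
    obtain ⟨m₀, -, hm₀⟩ := hu.1.mem_iff.1 (eventually_dist_mul_left_lt hLc (half_pos hε))
    filter_upwards [eventually_ge_atTop m₀] with m hm x
    rw [iterLieDeriv_conv_toL2 μ (hpq m) (hsymm m), dist_comm, dist_eq_norm]
    have hqi : Integrable (q m) μ := (hcont m).integrable_of_compactSpace
    have h1 : iterLieDeriv L f x = ∫ z, p m z * iterLieDeriv L f x ∂μ := by
      simp only [hpq]
      rw [integral_mul_const, integral_complex_ofReal, h_int, Complex.ofReal_one, one_mul]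
    have hpi : Integrable (p m) μ := (p m).contMDiff.continuous.integrable_of_compactSpace
    have hgi : Integrable (fun z => p m z * iterLieDeriv L f (z * x)) μ :=
      integrable_mul_continuous μ hpi (hLc.comp (continuous_mul_const x))
    rw [h1, ← integral_sub hgi (hpi.mul_const _)]
    refine lt_of_le_of_lt ?_ (half_lt_self hε)
    calc _ ≤ ∫ z, q m z * (ε / 2) ∂μ := by
          refine norm_integral_le_of_norm_le (hqi.mul_const _) (Eventually.of_forall fun z => ?_)
          rw [← mul_sub, norm_mul, hpq, Complex.norm_real, Real.norm_of_nonneg (hnn m z)]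
          by_cases hz : z ∈ u m
          · refine mul_le_mul_of_nonneg_left ?_ (hnn m z)
            rw [← dist_eq_norm]
            exact (hm₀ (hu.2 hm hz) x).le
          · rw [hsupp m z hz, zero_mul, zero_mul]
      _ = ε / 2 := by rw [integral_mul_const, h_int, one_mul]
  refine isClosed_closure.mem_of_tendsto hlim (Eventually.of_forall fun m => ?_)
  refine conv_mem_closure_finiteFun μ (p m) (fun w => ?_) _
  rw [hpq, hpq, hsymm, Complex.conj_ofReal]

end ApproximateIdentity

/-! ### Unitary representations on right-invariant function spaces. -/

section MatrixCoefficients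

/-- Evaluation at a point. -/
def evalAt {n : ℕ} {G : Type*} [TopologicalSpace G]
    [ChartedSpace (EuclideanSpace ℝ (Fin n)) G] (x : G) : SmoothFun n G →ₗ[ℂ] ℂ where
  toFun f := f x
  map_add' _ _ := rfl
  map_smul' _ _ := rfl

theorem sum_smul_smoothFun_apply {n : ℕ} {G : Type*} [TopologicalSpace G]
    [ChartedSpace (EuclideanSpace ℝ (Fin n)) G] {ι : Type*} (s : Finset ι) (c : ι → ℂ)
    (e : ι → SmoothFun n G) (x : G) : (∑ i ∈ s, c i • e i) x = ∑ i ∈ s, c i * e i x := by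
  exact (map_sum (evalAt (n := n) x) (fun i => c i • e i) s).trans
    (Finset.sum_congr rfl fun i _ => map_smul (evalAt x) (c i) (e i))

variable {n : ℕ} {G : Type*} [Group G] [TopologicalSpace G]
  [ChartedSpace (EuclideanSpace ℝ (Fin n)) G] [LieGroup (𝓡 n) ∞ G]
  [IsTopologicalGroup G] [CompactSpace G] [T2Space G] [SecondCountableTopology G]
  [MeasurableSpace G] [BorelSpace G] (μ : Measure G) [IsProbabilityMeasure μ]

theorem inner_rightTranslate [μ.IsMulRightInvariant] (g : G) (f h : SmoothFun n G) :
    inner ℂ (toL2 μ (rightTranslate g f)) (toL2 μ (rightTranslate g h)) =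
      inner ℂ (toL2 μ f) (toL2 μ h) := by
  rw [inner_toL2, inner_toL2]
  exact integral_mul_right_eq_self (μ := μ) (fun x => conj (f x) * h x) g

theorem rightTranslate_mul (g h : G) (f : SmoothFun n G) :
    rightTranslate (g * h) f = rightTranslate g (rightTranslate h f) := by
  ext x
  simp only [rightTranslate_apply, mul_assoc]

theorem rightTranslate_one (f : SmoothFun n G) : rightTranslate 1 f = f := by
  ext x
  simp only [rightTranslate_apply, mul_one]

theorem inner_rightTranslate_right [μ.IsMulRightInvariant] (g : G) (f h : SmoothFun n G) :
    inner ℂ (toL2 μ f) (toL2 μ (rightTranslate g h)) =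
      inner ℂ (toL2 μ (rightTranslate g⁻¹ f)) (toL2 μ h) := by
  rw [← inner_rightTranslate μ g⁻¹, ← rightTranslate_mul, inv_mul_cancel, rightTranslate_one]

/-- A basis of a space of smooth functions that is orthonormal for the `L²` inner product. -/
structure L2Basis (V : Submodule ℂ (SmoothFun n G)) (d : ℕ) where
  fn : Fin d → SmoothFun n G
  mem : ∀ j, fn j ∈ V
  orthonormal : Orthonormal ℂ fun j => toL2 μ (fn j)
  sum_inner_smul : ∀ f ∈ V, ∑ j, inner ℂ (toL2 μ (fn j)) (toL2 μ f) • fn j = f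

theorem exists_l2Basis [μ.IsOpenPosMeasure] (V : Submodule ℂ (SmoothFun n G))
    [FiniteDimensional ℂ V] : ∃ d, Nonempty (L2Basis μ V d) := by
  let K : Submodule ℂ (Lp ℂ 2 μ) := V.map (toL2Hom n μ)
  let e := stdOrthonormalBasis ℂ K
  have h : ∀ j, ∃ f ∈ V, toL2Hom n μ f = e j := fun j => (e j).2
  choose f hf hfe using h
  refine ⟨_, ⟨⟨f, hf, ?_, fun v hv => ?_⟩⟩⟩
  · have h1 := e.orthonormal.comp_linearIsometry K.subtypeₗᵢ
    have h2 : (fun j => toL2 μ (f j)) = K.subtypeₗᵢ ∘ e := funext hfe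
    rw [h2]
    exact h1
  · apply toL2_injective (n := n) μ
    have h1 := congrArg (Subtype.val) (e.sum_repr' ⟨toL2Hom n μ v, Submodule.mem_map_of_mem hv⟩)
    rw [map_sum]
    refine Eq.trans ?_ h1
    rw [AddSubmonoidClass.coe_finsetSum]
    refine Finset.sum_congr rfl fun j _ => ?_
    rw [map_smul, hfe, ← toL2Hom_apply, hfe]
    rfl

variable {μ} {V : Submodule ℂ (SmoothFun n G)} {d : ℕ} (e : L2Basis μ V d)

namespace L2Basis

/-- The linear combination with given coefficients. -/
def comb : (Fin d → ℂ) →ₗ[ℂ] SmoothFun n G := Fintype.linearCombination ℂ e.fn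

theorem comb_eq (c : Fin d → ℂ) : e.comb c = ∑ j, c j • e.fn j := by
  rw [comb, Fintype.linearCombination_apply]

theorem comb_mem (c : Fin d → ℂ) : e.comb c ∈ V := by
  rw [comb_eq]
  exact V.sum_mem fun j _ => V.smul_mem _ (e.mem j)

theorem comb_apply (c : Fin d → ℂ) (x : G) : e.comb c x = ∑ j, c j * e.fn j x := by
  rw [comb_eq, sum_smul_smoothFun_apply]

theorem toL2_comb (c : Fin d → ℂ) : toL2 μ (e.comb c) = ∑ j, c j • toL2 μ (e.fn j) := by
  rw [comb_eq, ← toL2Hom_apply, map_sum]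
  simp only [map_smul, toL2Hom_apply]

theorem inner_comb (j : Fin d) (c : Fin d → ℂ) :
    inner ℂ (toL2 μ (e.fn j)) (toL2 μ (e.comb c)) = c j := by
  rw [toL2_comb, e.orthonormal.inner_right_fintype]

theorem comb_injective : Function.Injective e.comb := fun c c' h => by
  ext j
  rw [← e.inner_comb j c, h, e.inner_comb]

theorem exists_comb_eq {f : SmoothFun n G} (hf : f ∈ V) : ∃ c, e.comb c = f :=
  ⟨_, (e.comb_eq _).trans (e.sum_inner_smul f hf)⟩

theorem norm_comb (c : EuclideanSpace ℂ (Fin d)) : ‖toL2 μ (e.comb c)‖ = ‖c‖ := by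
  have h : ‖toL2 μ (e.comb c)‖ ^ 2 = ‖c‖ ^ 2 := by
    have h1 := inner_self_eq_norm_sq_to_K (𝕜 := ℂ) (toL2 μ (e.comb c))
    rw [toL2_comb, e.orthonormal.inner_sum] at h1
    have h2 : ((‖toL2 μ (e.comb c)‖ ^ 2 : ℝ) : ℂ) = ((‖c‖ ^ 2 : ℝ) : ℂ) := by
      rw [EuclideanSpace.norm_sq_eq, toL2_comb]
      push_cast
      refine h1.symm.trans (Finset.sum_congr rfl fun j _ => ?_)
      rw [mul_comm, RCLike.mul_conj]
      rfl
    exact Complex.ofReal_injective h2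
  exact (sq_eq_sq₀ (norm_nonneg _) (norm_nonneg _)).1 h

/-- The matrix of the right translation by `g`. -/
def mat (g : G) : Matrix (Fin d) (Fin d) ℂ :=
  Matrix.of fun l j => inner ℂ (toL2 μ (e.fn l)) (toL2 μ (rightTranslate g (e.fn j)))

theorem isSmooth_mat (l j : Fin d) : IsSmooth n fun g => e.mat g l j := by
  have h1 : (fun g => e.mat g l j) = fun g => ∫ z, conj (e.fn l z) * e.fn j (z * g) ∂μ := by
    ext g
    exact inner_toL2 μ _ _
  have hc : Continuous fun z => conj (e.fn l z) :=
    Complex.continuous_conj.comp (e.fn l).contMDiff.continuous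
  rw [h1]
  exact isSmooth_integral_param (hc.integrable_of_compactSpace) (contMDiff_leftKernel (e.fn j))

theorem rightTranslate_fn (hV : IsRightInvariant V) (g : G) (j : Fin d) :
    rightTranslate g (e.fn j) = ∑ l, e.mat g l j • e.fn l :=
  (e.sum_inner_smul _ (hV g _ (e.mem j))).symm

theorem rightTranslate_comb (hV : IsRightInvariant V) (g : G) (c : Fin d → ℂ) :
    rightTranslate g (e.comb c) = e.comb ((e.mat g).mulVec c) := by
  rw [comb_eq, comb_eq, map_sum]
  simp only [map_smul, e.rightTranslate_fn hV, Matrix.mulVec, dotProduct, Finset.smul_sum,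
    Finset.sum_smul, smul_smul]
  rw [Finset.sum_comm]
  simp only [mul_comm]

theorem mat_mul (hV : IsRightInvariant V) (g h : G) : e.mat (g * h) = e.mat g * e.mat h := by
  ext l j
  rw [Matrix.mul_apply]
  have h1 : rightTranslate (g * h) (e.fn j) = ∑ m, e.mat h m j • rightTranslate g (e.fn m) := by
    rw [rightTranslate_mul, e.rightTranslate_fn hV, map_sum]
    simp only [map_smul]
  simp only [mat, Matrix.of_apply] at h1 ⊢
  rw [h1, ← toL2Hom_apply, ← toL2Hom_apply, map_sum, inner_sum]
  refine Finset.sum_congr rfl fun m _ => ?_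
  rw [map_smul, inner_smul_right, mul_comm]
  rfl

theorem mat_one : e.mat 1 = 1 := by
  ext l j
  simp only [mat, Matrix.of_apply, rightTranslate_one]
  rw [orthonormal_iff_ite.1 e.orthonormal, Matrix.one_apply]

theorem conj_mat [μ.IsMulRightInvariant] (g : G) (l j : Fin d) :
    conj (e.mat g l j) = e.mat g⁻¹ j l := by
  simp only [mat, Matrix.of_apply]
  rw [inner_conj_symm, inner_rightTranslate_right μ g⁻¹, inv_inv]

theorem star_mat [μ.IsMulRightInvariant] (g : G) : star (e.mat g) = e.mat g⁻¹ := by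
  ext l j
  exact e.conj_mat g j l

/-- The unitary representation given by right translations. -/
def hom [μ.IsMulRightInvariant] (hV : IsRightInvariant V) :
    G →* Matrix.unitaryGroup (Fin d) ℂ where
  toFun g := ⟨e.mat g, by
    rw [Matrix.mem_unitaryGroup_iff, e.star_mat, ← e.mat_mul hV, mul_inv_cancel, e.mat_one]⟩
  map_one' := Subtype.ext e.mat_one
  map_mul' g h := Subtype.ext (e.mat_mul hV g h)

theorem continuous_hom [μ.IsMulRightInvariant] (hV : IsRightInvariant V) :
    Continuous (e.hom hV) :=
  Continuous.subtype_mk (continuous_matrix fun l j => (e.isSmooth_mat l j).continuous) _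

/-- The injective map `comb` sends subrepresentations of the matrix representation to
right-invariant subspaces of `V`, so irreducibility transfers. -/
theorem isIrreducible_hom [μ.IsMulRightInvariant] (hV : IsRightInvariant V) (hV0 : V ≠ ⊥)
    (hirr : ∀ W ≤ V, IsRightInvariant W → W = ⊥ ∨ W = V) :
    (matrixRepresentation (e.hom hV)).IsIrreducible := by
  have key : ∀ U : Subrepresentation (matrixRepresentation (e.hom hV)), U = ⊥ ∨ U = ⊤ := by
    intro U
    have hinv : IsRightInvariant (U.toSubmodule.map e.comb) := by
      rintro g _ ⟨c, hc, rfl⟩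
      rw [e.rightTranslate_comb hV]
      exact Submodule.mem_map_of_mem (U.apply_mem_toSubmodule g hc)
    have hle : U.toSubmodule.map e.comb ≤ V := by
      rintro _ ⟨c, -, rfl⟩
      exact e.comb_mem c
    rcases hirr _ hle hinv with h | h
    · left
      apply Subrepresentation.toSubmodule_injective
      exact (Submodule.map_injective_of_injective e.comb_injective)
        (h.trans (Submodule.map_bot _).symm)
    · right
      apply Subrepresentation.toSubmodule_injective
      refine Submodule.eq_top_iff'.2 fun c => ?_
      have hc : e.comb c ∈ U.toSubmodule.map e.comb := by
        rw [h]
        exact e.comb_mem c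
      obtain ⟨c', hc', h'⟩ := hc
      rwa [← e.comb_injective h']
  have hnt : Nontrivial (Subrepresentation (matrixRepresentation (e.hom hV))) := by
    refine ⟨⊥, ⊤, fun h => hV0 ?_⟩
    have h' : (⊥ : Submodule ℂ (Fin d → ℂ)) = ⊤ :=
      congrArg Subrepresentation.toSubmodule h
    rw [Submodule.eq_bot_iff]
    intro f hf
    obtain ⟨c, rfl⟩ := e.exists_comb_eq hf
    have hc : c ∈ (⊥ : Submodule ℂ (Fin d → ℂ)) := h' ▸ Submodule.mem_top
    rw [(Submodule.mem_bot ℂ).1 hc, map_zero]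
  exact { eq_bot_or_eq_top := key }

/-- The irreducible representation on an irreducible space of functions. -/
def irrep [μ.IsMulRightInvariant] (hV : IsRightInvariant V) (hV0 : V ≠ ⊥)
    (hirr : ∀ W ≤ V, IsRightInvariant W → W = ⊥ ∨ W = V) : UnitaryIrrep G d where
  toHom := e.hom hV
  continuous_toHom := e.continuous_hom hV
  irreducible := e.isIrreducible_hom hV hV0 hirr

end L2Basis

end MatrixCoefficients

/-! ### Frozen operators and their action through the symbol. -/

section Freezing

theorem contMDiff_mul_complex {E H M : Type*} [NormedAddCommGroup E] [NormedSpace ℝ E]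
    [TopologicalSpace H] {I : ModelWithCorners ℝ E H} [TopologicalSpace M] [ChartedSpace H M]
    {f g : M → ℂ} (hf : ContMDiff I 𝓘(ℝ, ℂ) ∞ f) (hg : ContMDiff I 𝓘(ℝ, ℂ) ∞ g) :
    ContMDiff I 𝓘(ℝ, ℂ) ∞ fun x => f x * g x :=
  (contDiff_mul (𝕜 := ℝ) (𝔸 := ℂ)).contMDiff.comp (hf.prodMk_space hg)

variable {n : ℕ} {G : Type*} [Group G] [TopologicalSpace G]
  [ChartedSpace (EuclideanSpace ℝ (Fin n)) G] [LieGroup (𝓡 n) ∞ G]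

/-- Left translation of smooth functions. -/
def leftTranslate (g : G) : SmoothFun n G →ₗ[ℂ] SmoothFun n G where
  toFun f := ⟨fun x => f (g * x), (SmoothFun.isSmooth f).mul_left g⟩
  map_add' _ _ := rfl
  map_smul' _ _ := rfl

theorem leftTranslate_apply (g : G) (f : SmoothFun n G) (x : G) :
    leftTranslate g f x = f (g * x) := rfl

variable (A : SmoothFun n G →L[ℂ] SmoothFun n G)

/-- The value at `x` of the left-invariant operator whose right-convolution kernel is that of `A`
at `y`. -/
def frozen (y x : G) : SmoothFun n G →ₗ[ℂ] ℂ :=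
  evalAt y ∘ₗ (A : SmoothFun n G →ₗ[ℂ] SmoothFun n G) ∘ₗ leftTranslate (x * y⁻¹)

theorem frozen_apply (y x : G) (f : SmoothFun n G) :
    frozen A y x f = A (leftTranslate (x * y⁻¹) f) y := rfl

theorem frozen_self (x : G) (f : SmoothFun n G) : frozen A x x f = A f x := by
  have : leftTranslate (x * x⁻¹) f = f := by
    ext z
    rw [leftTranslate_apply, mul_inv_cancel, one_mul]
  rw [frozen_apply, this]

variable [IsTopologicalGroup G] [CompactSpace G] [T2Space G] [SecondCountableTopology G]
  [MeasurableSpace G] [BorelSpace G] {μ : Measure G} [IsProbabilityMeasure μ]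
  [μ.IsMulRightInvariant] {V : Submodule ℂ (SmoothFun n G)} {d : ℕ} (e : L2Basis μ V d)

namespace L2Basis

/-- The matrix entries as smooth functions. -/
def matFun (l j : Fin d) : SmoothFun n G := ⟨fun g => e.mat g l j, e.isSmooth_mat l j⟩

theorem matFun_apply (l j : Fin d) (g : G) : e.matFun l j g = e.mat g l j := rfl

/-- The entries of the adjoint matrices as smooth functions. -/
def adjFun (m j : Fin d) : SmoothFun n G :=
  ⟨fun g => conj (e.mat g j m),
    (e.isSmooth_mat j m).clm_comp Complex.conjCLE.toContinuousLinearMap⟩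

theorem reflect_adjFun (y z : G) (m j : Fin d) :
    reflect y (e.adjFun m j) z = e.mat (y⁻¹ * z) m j := by
  show conj (e.mat (z⁻¹ * y) j m) = _
  rw [e.conj_mat, mul_inv_rev, inv_inv]

/-- The entries of the symbol. -/
def symbolEntry (m j : Fin d) (y : G) : ℂ := A (reflect y (e.adjFun m j)) y

/-- Multiplicativity of the matrices writes the argument of `A`, which varies with `y`, as a
combination of finitely many fixed functions with coefficients smooth in `y`. -/
theorem isSmooth_symbolEntry (hV : IsRightInvariant V) (m j : Fin d) :
    IsSmooth n (e.symbolEntry A m j) := by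
  have h1 : e.symbolEntry A m j = fun y => ∑ l, conj (e.mat y l m) * A (e.matFun l j) y := by
    ext y
    have h2 : reflect y (e.adjFun m j) = ∑ l, conj (e.mat y l m) • e.matFun l j := by
      ext z
      rw [reflect_adjFun, sum_smul_smoothFun_apply, e.mat_mul hV, Matrix.mul_apply]
      simp only [conj_mat, matFun_apply]
    rw [symbolEntry, h2, map_sum]
    simp only [map_smul]
    rw [sum_smul_smoothFun_apply]
  rw [h1]
  exact contMDiff_finsetSum fun l _ => contMDiff_mul_complex
    ((e.isSmooth_mat l m).clm_comp Complex.conjCLE.toContinuousLinearMap)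
    (A (e.matFun l j)).contMDiff

theorem symbol_irrep (hV : IsRightInvariant V) (hV0 : V ≠ ⊥)
    (hirr : ∀ W ≤ V, IsRightInvariant W → W = ⊥ ∨ W = V) (y : G) :
    symbol A y (e.irrep hV hV0 hirr) =
      Matrix.toEuclideanCLM (𝕜 := ℂ) (Matrix.of fun m j => e.symbolEntry A m j y) := by
  rw [symbol, distFourierCoeff]
  congr 1
  ext m j
  -- The matrix coefficients are smooth, so the default value `0` of `pairing` is not used.
  exact dif_pos (e.adjFun m j).contMDiff

theorem isSmooth_symbol_irrep (hV : IsRightInvariant V) (hV0 : V ≠ ⊥)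
    (hirr : ∀ W ≤ V, IsRightInvariant W → W = ⊥ ∨ W = V) :
    IsSmooth n fun y => symbol A y (e.irrep hV hV0 hirr) := by
  have h1 : (fun y => symbol A y (e.irrep hV hV0 hirr)) = fun y => ∑ m, ∑ j,
      e.symbolEntry A m j y • Matrix.toEuclideanCLM (𝕜 := ℂ) (Matrix.single m j (1 : ℂ)) := by
    ext1 y
    rw [symbol_irrep, Matrix.matrix_eq_sum_single (Matrix.of fun m j => e.symbolEntry A m j y)]
    simp only [map_sum]
    refine Finset.sum_congr rfl fun m _ => Finset.sum_congr rfl fun j _ => ?_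
    rw [← map_smul, Matrix.smul_single, smul_eq_mul, mul_one, Matrix.of_apply]
  rw [h1]
  refine contMDiff_finsetSum fun m _ => contMDiff_finsetSum fun j _ => ?_
  exact (e.isSmooth_symbolEntry A hV m j).clm_comp
    ((ContinuousLinearMap.toSpanSingleton ℂ
      (Matrix.toEuclideanCLM (𝕜 := ℂ) (Matrix.single m j (1 : ℂ)))).restrictScalars ℝ)

/-- The value of a function at `x * y⁻¹ * z` is the value at `x` of its right translate by `y⁻¹ *
z`, whose matrix entries are the reflected `adjFun`. Applying `A` in `z` and evaluating at `y`
therefore multiplies the coordinates by the symbol matrix. -/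
theorem frozen_comb (hV : IsRightInvariant V) (c : Fin d → ℂ) (y x : G) :
    frozen A y x (e.comb c) = ∑ m, (∑ j, e.symbolEntry A m j y * c j) * e.fn m x := by
  have h1 : leftTranslate (x * y⁻¹) (e.comb c) =
      ∑ m, e.fn m x • ∑ j, c j • reflect y (e.adjFun m j) := by
    ext z
    rw [leftTranslate_apply, mul_assoc, ← rightTranslate_apply, e.rightTranslate_comb hV,
      comb_apply, sum_smul_smoothFun_apply]
    refine Finset.sum_congr rfl fun m _ => ?_
    rw [sum_smul_smoothFun_apply, mul_comm]
    refine congrArg (e.fn m x * ·) ?_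
    rw [Matrix.mulVec, dotProduct]
    refine Finset.sum_congr rfl fun j _ => ?_
    rw [reflect_adjFun, mul_comm]
  rw [frozen_apply, h1, map_sum A]
  simp only [map_smul]
  rw [sum_smul_smoothFun_apply]
  refine Finset.sum_congr rfl fun m _ => ?_
  rw [map_sum A, mul_comm]
  simp only [map_smul]
  rw [sum_smul_smoothFun_apply]
  congr 1
  exact Finset.sum_congr rfl fun j _ => mul_comm _ _

/-- Evaluation at `x` of the function with coefficients `S c`, as a function of the
endomorphism `S`. -/
def evalEnd (c : EuclideanSpace ℂ (Fin d)) (x : G) :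
    (EuclideanSpace ℂ (Fin d) →L[ℂ] EuclideanSpace ℂ (Fin d)) →L[ℝ] ℂ :=
  ((LinearMap.toContinuousLinearMap
    (evalAt x ∘ₗ e.comb ∘ₗ (WithLp.linearEquiv 2 ℂ (Fin d → ℂ)).toLinearMap)).comp
    (ContinuousLinearMap.apply ℂ (EuclideanSpace ℂ (Fin d)) c)).restrictScalars ℝ

theorem evalEnd_apply (c : EuclideanSpace ℂ (Fin d)) (x : G)
    (S : EuclideanSpace ℂ (Fin d) →L[ℂ] EuclideanSpace ℂ (Fin d)) :
    e.evalEnd c x S = e.comb (S c) x := rfl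

theorem frozen_comb_eq_evalEnd (hV : IsRightInvariant V) (hV0 : V ≠ ⊥)
    (hirr : ∀ W ≤ V, IsRightInvariant W → W = ⊥ ∨ W = V) (c : EuclideanSpace ℂ (Fin d))
    (y x : G) :
    frozen A y x (e.comb c) = e.evalEnd c x (symbol A y (e.irrep hV hV0 hirr)) := by
  rw [e.frozen_comb A hV, evalEnd_apply, symbol_irrep, comb_apply]
  rfl

end L2Basis

variable (μ) in
/-- The estimate `‖∂_y^α (frozen A y) f‖ ≤ C ‖f‖` in `L²` for all `f` in the space `V`, where the
functions `∂_y^α (frozen A y) f` also lie in `V`. -/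
def HasFrozenBound (k : ℕ) (b : Module.Basis (Fin n) ℝ (GroupLieAlgebra (𝓡 n) G)) (C : ℝ)
    (V : Submodule ℂ (SmoothFun n G)) : Prop :=
  ∀ f ∈ V, ContMDiff ((𝓡 n).prod (𝓡 n)) 𝓘(ℝ, ℂ) ∞
      (Function.uncurry fun y x => frozen A y x f) ∧
    ∀ α : Fin n → ℕ, ∑ i, α i ≤ k → ∀ y, ∃ u ∈ V,
      (∀ x, multiLieDeriv b α (fun y => frozen A y x f) y = u x) ∧
      ‖toL2 μ u‖ ≤ C * ‖toL2 μ f‖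

variable {k : ℕ} {b : Module.Basis (Fin n) ℝ (GroupLieAlgebra (𝓡 n) G)} {C : ℝ}

/-- The dependence on `y` is the symbol followed by the fixed linear map `evalEnd`, so derivatives
in `y` fall on the symbol. Orthonormal coordinates turn its operator norm into the `L²` bound. -/
theorem hasFrozenBound_of_irreducible [μ.IsOpenPosMeasure] [FiniteDimensional ℂ V]
    (hA : ∀ (x : G) (d : ℕ) (ξ : UnitaryIrrep G d) (α : Fin n → ℕ),
      ∑ i, α i ≤ k → ‖multiLieDeriv b α (fun y => symbol A y ξ) x‖ ≤ C)
    (hV : IsRightInvariant V) (hV0 : V ≠ ⊥)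
    (hirr : ∀ W ≤ V, IsRightInvariant W → W = ⊥ ∨ W = V) : HasFrozenBound A μ k b C V := by
  obtain ⟨d, ⟨e⟩⟩ := exists_l2Basis μ V
  intro f hf
  obtain ⟨c', rfl⟩ := e.exists_comb_eq hf
  obtain ⟨c, rfl⟩ : ∃ c : EuclideanSpace ℂ (Fin d), ⇑c = c' := ⟨WithLp.toLp 2 c', rfl⟩
  refine ⟨?_, fun α hα y => ?_⟩
  · have h1 : (Function.uncurry fun y x => frozen A y x (e.comb c)) = fun q : G × G =>
        ∑ m, (∑ j, e.symbolEntry A m j q.1 * c j) * e.fn m q.2 :=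
      funext fun q => e.frozen_comb A hV c q.1 q.2
    rw [h1]
    refine contMDiff_finsetSum fun m _ => contMDiff_mul_complex
      (contMDiff_finsetSum fun j _ => contMDiff_mul_complex ?_ contMDiff_const) ?_
    · exact (e.isSmooth_symbolEntry A hV m j).comp contMDiff_fst
    · exact (e.fn m).contMDiff.comp contMDiff_snd
  · set ξ := e.irrep hV hV0 hirr with hξ
    refine ⟨e.comb (multiLieDeriv b α (fun y => symbol A y ξ) y c), e.comb_mem _, fun x => ?_, ?_⟩
    · have h1 : (fun y => frozen A y x (e.comb c)) = fun y => e.evalEnd c x (symbol A y ξ) :=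
        funext fun y => e.frozen_comb_eq_evalEnd A hV hV0 hirr c y x
      rw [h1]
      exact congrFun (iterLieDeriv_clm_comp _ (e.isSmooth_symbol_irrep A hV hV0 hirr) _) y
    · rw [e.norm_comb, e.norm_comb]
      exact (ContinuousLinearMap.le_opNorm _ _).trans
        (mul_le_mul_of_nonneg_right (hA y d ξ α hα) (norm_nonneg _))

variable (μ) in
/-- The functions that are orthogonal to `W`. -/
def orthogonalFun (W : Submodule ℂ (SmoothFun n G)) : Submodule ℂ (SmoothFun n G) :=
  (W.map (toL2Hom n μ))ᗮ.comap (toL2Hom n μ)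

theorem mem_orthogonalFun {W : Submodule ℂ (SmoothFun n G)} {f : SmoothFun n G} :
    f ∈ orthogonalFun μ W ↔ ∀ w ∈ W, inner ℂ (toL2 μ w) (toL2 μ f) = 0 := by
  rw [orthogonalFun, Submodule.mem_comap, Submodule.mem_orthogonal]
  constructor
  · exact fun h w hw => h _ (Submodule.mem_map_of_mem hw)
  · rintro h _ ⟨w, hw, rfl⟩
    exact h w hw

theorem isRightInvariant_orthogonalFun {W : Submodule ℂ (SmoothFun n G)}
    (hW : IsRightInvariant W) : IsRightInvariant (orthogonalFun μ W) := by
  intro g f hf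
  rw [mem_orthogonalFun] at hf ⊢
  intro w hw
  rw [inner_rightTranslate_right]
  exact hf _ (hW _ _ hw)

theorem exists_add_orthogonalFun (W : Submodule ℂ (SmoothFun n G)) [FiniteDimensional ℂ W]
    (f : SmoothFun n G) : ∃ w ∈ W, ∃ w' ∈ orthogonalFun μ W, f = w + w' := by
  obtain ⟨_, ⟨w, hw, rfl⟩, z, hz, h⟩ :=
    (W.map (toL2Hom n μ)).exists_add_mem_mem_orthogonal (toL2Hom n μ f)
  refine ⟨w, hw, f - w, ?_, by abel⟩
  rw [orthogonalFun, Submodule.mem_comap, map_sub, h, add_sub_cancel_left]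
  exact hz

/-- The derivative functions stay in `W` and `W'`, hence remain orthogonal, so Pythagoras on both
sides preserves the constant `C`. -/
theorem HasFrozenBound.sup_orthogonal {W W' : Submodule ℂ (SmoothFun n G)} (hC : 0 ≤ C)
    (hW : HasFrozenBound A μ k b C W) (hW' : HasFrozenBound A μ k b C W')
    (hort : ∀ w ∈ W, ∀ w' ∈ W', inner ℂ (toL2 μ w) (toL2 μ w') = 0) :
    HasFrozenBound A μ k b C (W ⊔ W') := by
  intro f hf
  obtain ⟨w, hw, w', hw', rfl⟩ := Submodule.mem_sup.1 hf
  obtain ⟨h1, h2⟩ := hW w hw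
  obtain ⟨h1', h2'⟩ := hW' w' hw'
  have hslice : ∀ v, ContMDiff ((𝓡 n).prod (𝓡 n)) 𝓘(ℝ, ℂ) ∞
      (Function.uncurry fun y x => frozen A y x v) → ∀ x, IsSmooth n fun y => frozen A y x v :=
    fun v hv x => hv.comp (contMDiff_id.prodMk contMDiff_const)
  refine ⟨?_, fun α hα y => ?_⟩
  · have h3 : (Function.uncurry fun y x => frozen A y x (w + w')) = fun q =>
        Function.uncurry (fun y x => frozen A y x w) q +
        Function.uncurry (fun y x => frozen A y x w') q := funext fun q => map_add _ _ _
    rw [h3]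
    exact h1.add h1'
  · obtain ⟨u, hu, hux, hun⟩ := h2 α hα y
    obtain ⟨u', hu', hux', hun'⟩ := h2' α hα y
    refine ⟨u + u', Submodule.add_mem_sup hu hu', fun x => ?_, ?_⟩
    · have h3 : (fun y => frozen A y x (w + w')) =
          (fun y => frozen A y x w) + fun y => frozen A y x w' := funext fun y => map_add _ _ _
      rw [h3]
      refine (congrFun (iterLieDeriv_add _ (hslice w h1 x) (hslice w' h1' x)) y).trans ?_
      exact congrArg₂ (· + ·) (hux x) (hux' x)
    · refine le_of_sq_le_sq ?_ (by positivity)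
      have ha : toL2 μ (u + u') = toL2 μ u + toL2 μ u' := map_add (toL2Hom n μ) u u'
      have ha' : toL2 μ (w + w') = toL2 μ w + toL2 μ w' := map_add (toL2Hom n μ) w w'
      have hp : ‖toL2 μ u + toL2 μ u'‖ ^ 2 = ‖toL2 μ u‖ ^ 2 + ‖toL2 μ u'‖ ^ 2 := by
        simpa only [pow_two] using
          norm_add_sq_eq_norm_sq_add_norm_sq_of_inner_eq_zero _ _ (hort u hu u' hu')
      have hp' : ‖toL2 μ w + toL2 μ w'‖ ^ 2 = ‖toL2 μ w‖ ^ 2 + ‖toL2 μ w'‖ ^ 2 := by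
        simpa only [pow_two] using
          norm_add_sq_eq_norm_sq_add_norm_sq_of_inner_eq_zero _ _ (hort w hw w' hw')
      rw [mul_pow, ha, ha', hp, hp', mul_add, ← mul_pow, ← mul_pow]
      gcongr

theorem hasFrozenBound_bot : HasFrozenBound A μ k b C ⊥ := by
  intro f hf
  rw [Submodule.mem_bot] at hf
  subst hf
  have h0 : ∀ y x, frozen A y x 0 = 0 := fun y x => map_zero _
  refine ⟨?_, fun α _ y => ⟨0, Submodule.zero_mem _, fun x => ?_, ?_⟩⟩
  · have h3 : (Function.uncurry fun y x => frozen A y x 0) = fun _ => 0 := funext fun q => h0 _ _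
    rw [h3]
    exact contMDiff_const
  · simp only [h0]
    have h := congrFun (iterLieDeriv_clm_comp
      (List.ofFn fun i => List.replicate (α i) (b i)).flatten (f := fun _ : G => (0 : ℂ)) contMDiff_const (0 : ℂ →L[ℝ] ℂ)) y
    exact h
  · have h0 : toL2 μ (0 : SmoothFun n G) = 0 := map_zero (toL2Hom n μ)
    rw [h0, norm_zero, mul_zero]

/-- Strong induction on the dimension: a reducible space splits into a proper invariant subspace and
its orthogonal complement, which is invariant because right translations are unitary. The constant
is independent of the number of pieces. -/
theorem hasFrozenBound_of_finiteDimensional [μ.IsOpenPosMeasure] (hC : 0 ≤ C)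
    (hA : ∀ (x : G) (d : ℕ) (ξ : UnitaryIrrep G d) (α : Fin n → ℕ),
      ∑ i, α i ≤ k → ‖multiLieDeriv b α (fun y => symbol A y ξ) x‖ ≤ C)
    (V : Submodule ℂ (SmoothFun n G)) [FiniteDimensional ℂ V]
    (hV : IsRightInvariant V) : HasFrozenBound A μ k b C V := by
  induction hm : Module.finrank ℂ V using Nat.strong_induction_on generalizing V with
  | _ m ih =>
  subst hm
  by_cases hV0 : V = ⊥
  · rw [hV0]
    exact hasFrozenBound_bot A
  by_cases hirr : ∀ W ≤ V, IsRightInvariant W → W = ⊥ ∨ W = V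
  · exact hasFrozenBound_of_irreducible A hA hV hV0 hirr
  push Not at hirr
  obtain ⟨W, hWV, hW, hW0, hWne⟩ := hirr
  have hWfd : FiniteDimensional ℂ W := Submodule.finiteDimensional_of_le hWV
  set W' := V ⊓ orthogonalFun μ W with hW'
  have hW'fd : FiniteDimensional ℂ W' := Submodule.finiteDimensional_of_le inf_le_left
  have hort : ∀ w ∈ W, ∀ w' ∈ W', inner ℂ (toL2 μ w) (toL2 μ w') = 0 := fun w hw w' hw' =>
    mem_orthogonalFun.1 hw'.2 w hw
  have hW'ne : W' ≠ V := by
    intro h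
    refine hW0 ((Submodule.eq_bot_iff _).2 fun w hw => ?_)
    apply toL2_injective (n := n) μ
    rw [map_zero, toL2Hom_apply]
    exact inner_self_eq_zero.1 (hort w hw w (h ▸ hWV hw))
  have hsup : V = W ⊔ W' := by
    refine le_antisymm (fun f hf => ?_) (sup_le hWV inf_le_left)
    obtain ⟨w, hw, w', hw', rfl⟩ := exists_add_orthogonalFun (μ := μ) W f
    refine Submodule.add_mem_sup hw ⟨?_, hw'⟩
    simpa using V.sub_mem hf (hWV hw)
  have hWinv : IsRightInvariant W' := fun g f hf =>
    ⟨hV g f hf.1, isRightInvariant_orthogonalFun hW g f hf.2⟩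
  have h1 := ih _ (Submodule.finrank_lt_finrank_of_lt (lt_of_le_of_ne hWV hWne)) W hW rfl
  have h2 := ih _ (Submodule.finrank_lt_finrank_of_lt
    (lt_of_le_of_ne inf_le_left hW'ne)) W' hWinv rfl
  rw [hsup]
  exact h1.sup_orthogonal A hC h2 hort

end Freezing

/-! ### The `L²` estimate and the extension. -/

section Boundedness

variable {n : ℕ} {G : Type*} [Group G] [TopologicalSpace G]
  [ChartedSpace (EuclideanSpace ℝ (Fin n)) G] [LieGroup (𝓡 n) ∞ G]
  [IsTopologicalGroup G] [CompactSpace G] [T2Space G] [SecondCountableTopology G]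
  [MeasurableSpace G] [BorelSpace G] {μ : Measure G} [μ.IsHaarMeasure] [IsProbabilityMeasure μ]
  [μ.IsMulRightInvariant] (A : SmoothFun n G →L[ℂ] SmoothFun n G)
  {k : ℕ} {b : Module.Basis (Fin n) ℝ (GroupLieAlgebra (𝓡 n) G)} {C : ℝ}

/-- Sobolev in the freezing variable `y` is evaluated on the diagonal `y = x`; after Fubini, the
bound for each fixed `y` applies, and integrating over `y` costs nothing since `μ` has mass one. -/
theorem norm_toL2_sq_le_of_hasFrozenBound {S : ℝ} (hS : 0 ≤ S)
    (hsob : ∀ f : G → ℂ, IsSmooth n f → ∀ x,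
      ‖f x‖ ^ 2 ≤ S * ∑ α ∈ multiIdx n k, ∫ y, ‖multiLieDeriv b α f y‖ ^ 2 ∂μ)
    {V : Submodule ℂ (SmoothFun n G)} (hV : HasFrozenBound A μ k b C V) {f : SmoothFun n G}
    (hf : f ∈ V) :
    ‖toL2 μ (A f)‖ ^ 2 ≤ S * (multiIdx n k).card * C ^ 2 * ‖toL2 μ f‖ ^ 2 := by
  obtain ⟨hsm, hbd⟩ := hV f hf
  set D : (Fin n → ℕ) → G × G → ℝ := fun α q =>
    ‖multiLieDeriv b α (fun y => frozen A y q.2 f) q.1‖ ^ 2 with hD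
  have hDc : ∀ α, Continuous (D α) := fun α =>
    (contMDiff_iterLieDeriv_param (f := fun y x => frozen A y x f) hsm _).continuous.norm.pow 2
  have hDi : ∀ α, Integrable (D α) (μ.prod μ) := fun α => (hDc α).integrable_of_compactSpace
  have hpt : ∀ x, ‖A f x‖ ^ 2 ≤ S * ∑ α ∈ multiIdx n k, ∫ y, D α (y, x) ∂μ := fun x => by
    rw [← frozen_self A x f]
    exact hsob (fun y => frozen A y x f) (hsm.comp (contMDiff_id.prodMk contMDiff_const)) x
  have hAi : Integrable (fun x => ‖A f x‖ ^ 2) μ :=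
    ((A f).contMDiff.continuous.norm.pow 2).integrable_of_compactSpace
  have hIi : ∀ α, Integrable (fun x => ∫ y, D α (y, x) ∂μ) μ := fun α => (hDi α).integral_prod_right
  have hα : ∀ α ∈ multiIdx n k, ∫ x, (∫ y, D α (y, x) ∂μ) ∂μ ≤ C ^ 2 * ‖toL2 μ f‖ ^ 2 := by
    intro α hα
    rw [integral_integral_swap (f := fun x y => D α (y, x)) (hDi α).swap]
    have hle : ∀ y, ∫ x, D α (y, x) ∂μ ≤ C ^ 2 * ‖toL2 μ f‖ ^ 2 := by
      intro y
      obtain ⟨u, -, hu, hun⟩ := hbd α (mem_multiIdx.1 hα) y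
      have h1 : ∫ x, D α (y, x) ∂μ = ‖toL2 μ u‖ ^ 2 := by
        rw [norm_toL2_sq]
        simp only [hD, hu]
      rw [h1, ← mul_pow]
      exact pow_le_pow_left₀ (norm_nonneg _) hun 2
    calc _ ≤ ∫ _, C ^ 2 * ‖toL2 μ f‖ ^ 2 ∂μ :=
          integral_mono (hDi α).integral_prod_left (integrable_const _) hle
      _ = _ := by simp
  rw [norm_toL2_sq]
  calc ∫ x, ‖A f x‖ ^ 2 ∂μ ≤ ∫ x, S * ∑ α ∈ multiIdx n k, ∫ y, D α (y, x) ∂μ ∂μ :=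
        integral_mono hAi ((integrable_finsetSum _ fun α _ => hIi α).const_mul S) hpt
    _ = S * ∑ α ∈ multiIdx n k, ∫ x, (∫ y, D α (y, x) ∂μ) ∂μ := by
        rw [integral_const_mul, integral_finsetSum _ fun α _ => hIi α]
    _ ≤ S * ∑ α ∈ multiIdx n k, C ^ 2 * ‖toL2 μ f‖ ^ 2 :=
        mul_le_mul_of_nonneg_left (Finset.sum_le_sum hα) hS
    _ = _ := by
        rw [Finset.sum_const, nsmul_eq_mul]
        ring

theorem exists_norm_toL2_le (hk : (n : ℝ) / 2 < k)
    (hA : ∀ (x : G) (d : ℕ) (ξ : UnitaryIrrep G d) (α : Fin n → ℕ),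
      ∑ i, α i ≤ k → ‖multiLieDeriv b α (fun y => symbol A y ξ) x‖ ≤ C) :
    ∃ K : ℝ, ∀ f, ‖toL2 μ (A f)‖ ≤ K * ‖toL2 μ f‖ := by
  obtain ⟨S, hS, hsob⟩ := exists_sobolev μ b hk
  have hA' : ∀ (x : G) (d : ℕ) (ξ : UnitaryIrrep G d) (α : Fin n → ℕ),
      ∑ i, α i ≤ k → ‖multiLieDeriv b α (fun y => symbol A y ξ) x‖ ≤ |C| :=
    fun x d ξ α hα => (hA x d ξ α hα).trans (le_abs_self C)
  set K := S * (multiIdx n k).card * |C| ^ 2 with hK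
  have hK0 : 0 ≤ K := by positivity
  have hfin : ∀ f ∈ finiteFun n G, ‖toL2 μ (A f)‖ ^ 2 ≤ K * ‖toL2 μ f‖ ^ 2 := by
    rintro f ⟨V, hVfd, hV, hf⟩
    exact norm_toL2_sq_le_of_hasFrozenBound A hS hsob
      (hasFrozenBound_of_finiteDimensional A (abs_nonneg C) hA' V hV) hf
  have hclosed : IsClosed {f : SmoothFun n G | ‖toL2 μ (A f)‖ ^ 2 ≤ K * ‖toL2 μ f‖ ^ 2} :=
    isClosed_le (((continuous_toL2 μ).comp A.continuous).norm.pow 2)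
      (continuous_const.mul ((continuous_toL2 μ).norm.pow 2))
  refine ⟨√K, fun f => ?_⟩
  -- Continuity of `A` on `C^∞(G)` makes the estimate a closed condition, so it passes from the
  -- dense subspace to every smooth function.
  have h := hclosed.closure_subset_iff.2 hfin (dense_finiteFun μ f)
  refine le_of_sq_le_sq ?_ (by positivity)
  rw [mul_pow, Real.sq_sqrt hK0]
  exact h

/-- An operator that is defined on a subspace of a Hilbert space and bounded there extends to
a bounded operator on the whole space. -/
theorem exists_clm_extension {E H F : Type*} [AddCommGroup E] [Module ℂ E]
    [NormedAddCommGroup H] [InnerProductSpace ℂ H] [CompleteSpace H] [NormedAddCommGroup F]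
    [NormedSpace ℂ F] [CompleteSpace F] (ι : E →ₗ[ℂ] H) (B : E →ₗ[ℂ] F) {K : ℝ}
    (hB : ∀ f, ‖B f‖ ≤ K * ‖ι f‖) : ∃ T : H →L[ℂ] F, ∀ f, T (ι f) = B f := by
  let R : Submodule ℂ H := (LinearMap.range ι).topologicalClosure
  have : CompleteSpace R := (Submodule.isClosed_topologicalClosure _).completeSpace_coe
  have hmem : ∀ f, ι f ∈ R := fun f =>
    Submodule.le_topologicalClosure _ (LinearMap.mem_range_self ι f)
  let j : E →ₗ[ℂ] R := ι.codRestrict R hmem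
  have hdense : DenseRange j := by
    intro r
    rw [closure_subtype, ← range_comp]
    exact r.2
  -- The extension by density reaches only the closure of the range; the orthogonal projection
  -- handles the rest of `H`, so density of the range is not needed.
  refine ⟨(B.extendOfNorm j).comp R.orthogonalProjectionOnto, fun f => ?_⟩
  have h1 : R.orthogonalProjectionOnto (ι f) = j f :=
    Submodule.orthogonalProjectionOnto_mem_subspace_eq_self (K := R) (j f)
  rw [ContinuousLinearMap.comp_apply, h1, LinearMap.extendOfNorm_eq hdense ⟨K, hB⟩]

end Boundedness

end LieGroupSymbol

end

theorem mainTheorem5 {n : ℕ} {G : Type*} [Group G] [TopologicalSpace G] [T2Space G]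
    [CompactSpace G] [ChartedSpace (EuclideanSpace ℝ (Fin n)) G] [LieGroup (𝓡 n) ∞ G]
    [MeasurableSpace G] [BorelSpace G]
    (μ : Measure G) [μ.IsHaarMeasure] [IsProbabilityMeasure μ]
    (k : ℕ) (hk : (n : ℝ) / 2 < k)
    (b : Module.Basis (Fin n) ℝ (GroupLieAlgebra (𝓡 n) G))
    (A : LieGroupSymbol.SmoothFun n G →L[ℂ] LieGroupSymbol.SmoothFun n G)
    (C : ℝ)
    (hA : ∀ (x : G) (d : ℕ) (ξ : LieGroupSymbol.UnitaryIrrep G d) (α : Fin n → ℕ),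
      ∑ i, α i ≤ k →
        ‖LieGroupSymbol.multiLieDeriv b α (fun y => LieGroupSymbol.symbol A y ξ) x‖ ≤ C) :
    ∃ T : Lp ℂ 2 μ →L[ℂ] Lp ℂ 2 μ, ∀ f : LieGroupSymbol.SmoothFun n G,
      T (LieGroupSymbol.toL2 μ f) = LieGroupSymbol.toL2 μ (A f) := by
  have : IsTopologicalGroup G := topologicalGroup_of_lieGroup (𝓡 n) ∞
  have : SecondCountableTopology G :=
    ChartedSpace.secondCountable_of_sigmaCompact (EuclideanSpace ℝ (Fin n)) G
  have := LieGroupSymbol.isMulRightInvariant_of_compactSpace μ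
  obtain ⟨K, hK⟩ := LieGroupSymbol.exists_norm_toL2_le (μ := μ) A hk hA
  obtain ⟨T, hT⟩ := LieGroupSymbol.exists_clm_extension (LieGroupSymbol.toL2Hom n μ)
    (LieGroupSymbol.toL2Hom n μ ∘ₗ A.toLinearMap) (K := K) fun f => hK f
  exact ⟨T, fun f => hT f⟩
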